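/- Let $n\in\mathbb{N}$. A prefix machine is a partial computable function on $\{0,1\}^*$ whose domain is prefix-free. Fix a universal prefix machine $U$, i.e. a prefix machine such that for every prefix machine $M$ there is a constant $c_M$ such that, whenever $M(\pi)=w$, there is $\pi'$ with $U(\pi')=w$ and $|\pi'|\le|\pi|+c_M$. For $w\in\{0,1\}^*$ let $K(w)=\min\{|\pi| : U(\pi)=w\}$, and extend $K$ to $\mathbb{N}$ and $\mathbb{Q}^n$ by standard binary encodings. For $E\subseteq\mathbb{R}^n$ let $K(E)=\min\{K(q) : q\in E\cap\mathbb{Q}^n\}$ (with $\min\emptyset=\infty$), and let $\kappa(E)=2^{-K(E)}$ (with $2^{-\infty}=0$); $\kappa$ is an outer measure on $\mathbb{R}^n$. An outer measure $\mu:\mathcal{P}(\mathbb{R}^n)\to[0,\infty]$ is *strongly finite* if $\mu(\mathbb{R}^n\setminus\mathbb{Q}^n)=0$ and $\sum_{q\in\mathbb{Q}^n}\mu(\{q\})<\infty$. It is *lower semicomputable* if (a) for every $\varepsilon>0$ there is a finite set $A\subseteq\mathbb{Q}^n$ with $\mu(\mathbb{R}^n\setminus A)<\varepsilon$, and (b)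 there is a computable function $\hat\mu$, taking a finite set $A\subseteq\mathbb{Q}^n$ and $t\in\mathbb{N}$ to a rational number $\hat\mu(A,t)\ge 0$, such that $\hat\mu(A,s)\le\hat\mu(A,t)\le\mu(A)$ whenever $s\le t$, and $\lim_{t\to\infty}\hat\mu(A,t)=\mu(A)$ for every $A$. For $r\in\mathbb{N}$ and $m\in\mathbb{Z}^n$, the $r$-dyadic cube with address $m$ is $2^{-r}\cdot\prod_{i=1}^n[m_i,m_i+1)$; let $\mathcal{Q}^{(r)}$ be the set of all $r$-dyadic cubes. An outer measure $\mu$ *dominates* $\nu$ on dyadic cubes *with factor* $\beta:\mathbb{N}\to(0,\infty)$ if $\beta(r)=2^{-o(r)}$ as $r\to\infty$ and $\mu(Q)\ge\beta(r)\,\nu(Q)$ for all $r\in\mathbb{N}$ and $Q\in\mathcal{Q}^{(r)}$. It is *locally optimal* if it is strongly finite and lower semicomputable and, for every strongly finite, lower semicomputable outer measure $\nu$ on $\mathbb{R}^n$, it dominates $\nu$ on dyadic cubes with some factor $\beta$. **Theorem.** The outer measure $\kappa$ on $\mathbb{R}^n$ is locally optimal. Moreover, there is a constant $c\in\mathbb{N}$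 such that for every strongly finite, lower semicomputable outer measure $\nu$ on $\mathbb{R}^n$ there is $\alpha\in(0,\infty)$ such that $\kappa$ dominates $\nu$ on dyadic cubes with factor $\beta(r)=\alpha\cdot 2^{-(K(r)+c)}$. -/

import Mathlib

open MeasureTheory Filter Topology Asymptotics
open scoped NNReal ENNReal

namespace KolmogorovOuter

/-! ### Prefix machines and prefix Kolmogorov complexity -/

/-- A prefix machine: a partial computable function on binary strings whose domain is
prefix-free. -/
structure IsPrefixMachine (M : List Bool →. List Bool) : Prop where
  partrec : Partrec M
  prefixFree : ∀ π π' : List Bool, (M π).Dom → (M π').Dom → π <+: π' → π = π'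

/-- `U` is a universal prefix machine: it simulates every prefix machine `M` with programs that
are longer by at most an additive constant depending on `M`. (If each `M` is simulated through
`U (σ ++ π) = M π` for a fixed string `σ`, this holds with the length of `σ` as the constant.) -/
structure IsUniversalPrefixMachine (U : List Bool →. List Bool) : Prop where
  isPrefixMachine : IsPrefixMachine U
  simulates : ∀ M : List Bool →. List Bool, IsPrefixMachine M →
    ∃ c : ℕ, ∀ π w : List Bool, w ∈ M π →
      ∃ π' : List Bool, w ∈ U π' ∧ π'.length ≤ π.length + c

/-- `K(w)`, the minimal length of a program that makes `U` output the string `w`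
(`⊤` if there is none, which does not happen for universal `U`). -/
noncomputable def stringComplexity (U : List Bool →. List Bool) (w : List Bool) : ℕ∞ :=
  ⨅ (π : List Bool) (_ : w ∈ U π), (π.length : ℕ∞)

/-- The standard binary encoding of an effectively coded countable type. -/
def binaryCode {α : Type} [Primcodable α] (a : α) : List Bool :=
  Nat.bits (Encodable.encode a)

/-- A rational number, coded as its reduced numerator and denominator. -/
def ratCode (q : ℚ) : ℤ × ℕ := (q.num, q.den)

/-- A rational point, coded coordinatewise. -/
def pointCode {n : ℕ} (q : Fin n → ℚ) : Fin n → ℤ × ℕ := fun i => ratCode (q i)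

/-- `K(r)` for a natural number `r`. -/
noncomputable def natComplexity (U : List Bool →. List Bool) (r : ℕ) : ℕ∞ :=
  stringComplexity U (binaryCode r)

/-- `K(q)` for a rational point `q`. -/
noncomputable def pointComplexity (U : List Bool →. List Bool) {n : ℕ} (q : Fin n → ℚ) : ℕ∞ :=
  stringComplexity U (binaryCode (pointCode q))

/-- The inclusion of `ℚⁿ` in `ℝⁿ`. -/
noncomputable def ratPoint {n : ℕ} (q : Fin n → ℚ) : EuclideanSpace ℝ (Fin n) :=
  WithLp.toLp 2 (fun i => (q i : ℝ))

/-- `K(E)`, the least complexity of a rational point of `E`; it is `⊤` if `E` has none. -/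
noncomputable def setComplexity (U : List Bool →. List Bool) {n : ℕ}
    (E : Set (EuclideanSpace ℝ (Fin n))) : ℕ∞ :=
  ⨅ (q : Fin n → ℚ) (_ : ratPoint q ∈ E), pointComplexity U q

/-- `2 ^ (-k)`, with `2 ^ (-∞) = 0`. -/
noncomputable def twoPowNeg : ℕ∞ → ℝ≥0
  | ⊤ => 0
  | (k : ℕ) => (2⁻¹ : ℝ≥0) ^ k

theorem twoPowNeg_top : twoPowNeg ⊤ = 0 := rfl

theorem twoPowNeg_coe (k : ℕ) : twoPowNeg (k : ℕ∞) = (2⁻¹ : ℝ≥0) ^ k := rfl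

theorem twoPowNeg_antitone : Antitone twoPowNeg := by
  intro a b hab
  induction b using ENat.recTopCoe with
  | top => rw [twoPowNeg_top]; exact zero_le
  | coe b =>
    induction a using ENat.recTopCoe with
    | top => simp at hab
    | coe a =>
      rw [twoPowNeg_coe, twoPowNeg_coe]
      exact pow_le_pow_of_le_one zero_le (by norm_num [inv_le_one_iff₀]) (by exact_mod_cast hab)

theorem setComplexity_anti (U : List Bool →. List Bool) {n : ℕ}
    {E F : Set (EuclideanSpace ℝ (Fin n))} (h : E ⊆ F) :
    setComplexity U F ≤ setComplexity U E :=
  le_iInf₂ fun q hq => iInf₂_le q (h hq)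

theorem setComplexity_iUnion_attained (U : List Bool →. List Bool) {n : ℕ}
    (E : ℕ → Set (EuclideanSpace ℝ (Fin n))) :
    setComplexity U (⋃ i, E i) = ⊤ ∨ ∃ i, setComplexity U (E i) ≤ setComplexity U (⋃ i, E i) := by
  by_cases h : setComplexity U (⋃ i, E i) = ⊤
  · exact Or.inl h
  · refine Or.inr ?_
    by_contra! hlt
    have key : setComplexity U (⋃ i, E i) + 1 ≤ setComplexity U (⋃ i, E i) := by
      conv_rhs => unfold setComplexity
      refine le_iInf₂ fun q hq => ?_
      obtain ⟨i, hi⟩ := Set.mem_iUnion.1 hq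
      exact Order.add_one_le_of_lt ((hlt i).trans_le (iInf₂_le q hi))
    exact absurd ((ENat.add_one_le_iff h).1 key) (lt_irrefl _)

/-- The outer measure `κ(E) = 2 ^ (-K(E))` on `ℝⁿ`. -/
noncomputable def kappa (U : List Bool →. List Bool) (n : ℕ) :
    OuterMeasure (EuclideanSpace ℝ (Fin n)) where
  measureOf E := (twoPowNeg (setComplexity U E) : ℝ≥0∞)
  empty := by
    have : setComplexity U (∅ : Set (EuclideanSpace ℝ (Fin n))) = ⊤ := by
      simp [setComplexity]
    rw [this, twoPowNeg_top, ENNReal.coe_zero]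
  mono h := ENNReal.coe_le_coe.2 (twoPowNeg_antitone (setComplexity_anti U h))
  iUnion_nat E _ := by
    rcases setComplexity_iUnion_attained U E with h | ⟨i, hi⟩
    · rw [h, twoPowNeg_top, ENNReal.coe_zero]; exact zero_le
    · exact (ENNReal.coe_le_coe.2 (twoPowNeg_antitone hi)).trans
        (ENNReal.le_tsum (f := fun i => (twoPowNeg (setComplexity U (E i)) : ℝ≥0∞)) i)

/-! ### Properties of outer measures on `ℝⁿ` -/

/-- `μ` is supported on `ℚⁿ`. -/
def IsSupportedOnRat {n : ℕ} (μ : OuterMeasure (EuclideanSpace ℝ (Fin n))) : Prop :=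
  μ (Set.range (ratPoint (n := n)))ᶜ = 0

/-- `μ` is finitely supported on `ℚⁿ`. -/
def IsFinitelySupportedOnRat {n : ℕ} (μ : OuterMeasure (EuclideanSpace ℝ (Fin n))) : Prop :=
  ∀ ε : ℝ≥0, 0 < ε → ∃ A : Finset (Fin n → ℚ), μ (ratPoint '' (A : Set (Fin n → ℚ)))ᶜ < ε

/-- `μ` is strongly finite: supported on `ℚⁿ`, with summable point masses there. -/
def IsStronglyFinite {n : ℕ} (μ : OuterMeasure (EuclideanSpace ℝ (Fin n))) : Prop :=
  IsSupportedOnRat μ ∧ ∑' q : Fin n → ℚ, μ {ratPoint q} < ∞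

/-- Computability of a function of a finite set of rational points and a natural number, with
nonnegative rational values: an algorithm takes any list of the elements of the set to the reduced
fraction of the value. -/
def IsComputableOnFinsets {n : ℕ} (f : Finset (Fin n → ℚ) → ℕ → ℚ≥0) : Prop :=
  ∃ F : List (Fin n → ℤ × ℕ) → ℕ → ℤ × ℕ, Computable₂ F ∧
    ∀ (l : List (Fin n → ℚ)) (t : ℕ), F (l.map pointCode) t = ratCode (f l.toFinset t : ℚ)

/-- `μ` is lower semicomputable: finitely supported on `ℚⁿ`, and its values on finite sets of
rational points are limits of a computable nondecreasing sequence of lower bounds. -/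
def IsLowerSemicomputable {n : ℕ} (μ : OuterMeasure (EuclideanSpace ℝ (Fin n))) : Prop :=
  IsFinitelySupportedOnRat μ ∧
    ∃ f : Finset (Fin n → ℚ) → ℕ → ℚ≥0, IsComputableOnFinsets f ∧
      (∀ (A : Finset (Fin n → ℚ)) (s t : ℕ), s ≤ t →
        f A s ≤ f A t ∧ ((f A t : ℝ≥0) : ℝ≥0∞) ≤ μ (ratPoint '' (A : Set (Fin n → ℚ)))) ∧
      ∀ A : Finset (Fin n → ℚ),
        Tendsto (fun t => ((f A t : ℝ≥0) : ℝ≥0∞)) atTop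
          (𝓝 (μ (ratPoint '' (A : Set (Fin n → ℚ)))))

/-! ### Dyadic cubes, domination and local optimality -/

/-- The half-open unit cube at `m`. -/
def unitCube {n : ℕ} (m : Fin n → ℤ) : Set (EuclideanSpace ℝ (Fin n)) :=
  {x | ∀ i, (m i : ℝ) ≤ x i ∧ x i < (m i : ℝ) + 1}

/-- The `r`-dyadic cube with address `m`. -/
def dyadicCube {n : ℕ} (r : ℕ) (m : Fin n → ℤ) : Set (EuclideanSpace ℝ (Fin n)) :=
  (fun x => ((2 : ℝ) ^ r)⁻¹ • x) '' unitCube m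

/-- The family of all `r`-dyadic cubes. -/
def dyadicCubes (n : ℕ) (r : ℕ) : Set (Set (EuclideanSpace ℝ (Fin n))) :=
  Set.range (dyadicCube r)

/-- `μ` dominates `ν` on the families `𝒜 r` with factor `β : ℕ → (0, ∞)`, where
`β r = 2 ^ (-o(r))`. -/
def DominatesWith {n : ℕ} (β : ℕ → ℝ≥0) (μ ν : OuterMeasure (EuclideanSpace ℝ (Fin n)))
    (𝒜 : ℕ → Set (Set (EuclideanSpace ℝ (Fin n)))) : Prop :=
  (∀ r, 0 < β r) ∧
  (∃ g : ℕ → ℝ, g =o[atTop] (fun r : ℕ => (r : ℝ)) ∧ ∀ r, (β r : ℝ) = (2 : ℝ) ^ (-g r)) ∧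
  ∀ r, ∀ E ∈ 𝒜 r, (β r : ℝ≥0∞) * ν E ≤ μ E

/-- `μ` dominates `ν` on the families `𝒜 r`. -/
def Dominates {n : ℕ} (μ ν : OuterMeasure (EuclideanSpace ℝ (Fin n)))
    (𝒜 : ℕ → Set (Set (EuclideanSpace ℝ (Fin n)))) : Prop :=
  ∃ β : ℕ → ℝ≥0, DominatesWith β μ ν 𝒜

/-- Local optimality of an outer measure on `ℝⁿ`. -/
def IsLocallyOptimal {n : ℕ} (μ : OuterMeasure (EuclideanSpace ℝ (Fin n))) : Prop :=
  (IsStronglyFinite μ ∧ IsLowerSemicomputable μ) ∧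
  ∀ ν : OuterMeasure (EuclideanSpace ℝ (Fin n)),
    IsStronglyFinite ν → IsLowerSemicomputable ν → Dominates μ ν (dyadicCubes n)

end KolmogorovOuter

namespace KolmogorovOuter

/-! ### Primitive recursive functions -/

/-! The heart of the matter is a coding argument: a dyadic cube that carries much `ν`-mass contains
a rational point that is cheap to describe, namely its least corner. The cubes of a fixed level `r`
are disjoint and `ν` is concentrated on rational points, so countable subadditivity bounds the sum
of `ν(Q)` over these cubes by the total point mass `s < ∞`, although `ν` need not be additive
(`tsum_dyadicCube_le`).

For every program `π` of `r`, every cube `Q` of level `r` and every `k` with `2^(-k) ≤ ν(Q)`,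
request a description of the corner of `Q` of length `|π| + k`. Summing over `k` costs a factor 2,
summing over the cubes gives at most `2s`, and Kraft's inequality for `U` bounds the remaining sum
of `2^(-|π|)` by 1 (`tsum_corner_requests_le`). The requests that finite parts of cubes certify can
be enumerated, because `ν` is approximated computably from below. The Kraft–Chaitin construction
(`exists_prefixMachine_of_requests`, `exists_stringComplexity_le`) then serves them by a prefix
machine, and universality gives `K(corner) ≤ K(r) + k + O(1)`.

A finite subset of `Q` carries more than half of `ν(Q)`, so `2^(-k)` can be taken comparable to
`ν(Q)`. This yields `κ(Q) ≥ α * 2^(-K(r)) * ν(Q)`, and the factor is `2^(-o(r))` because `K(r)` is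
at most logarithmic in `r`.

That `κ` itself qualifies is easier: shortest programs of distinct points are distinct, so Kraft's
inequality gives strong finiteness, only finitely many points have complexity at most `k`, and
running `U` in stages approximates `κ` from below. -/

theorem primrec_int_toNat : Primrec Int.toNat := by
  have h : Primrec fun z : ℤ =>
      bif (Encodable.encode z).bodd then 0 else (Encodable.encode z).div2 :=
    Primrec.cond (Primrec.nat_bodd.comp Primrec.encode) (Primrec.const 0)
      (Primrec.nat_div2.comp Primrec.encode)
  refine h.of_eq fun z => ?_
  rcases z with k | k
  · have : Encodable.encode (Int.ofNat k) = 2 * k := rfl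
    rw [this]; simp
  · have : Encodable.encode (Int.negSucc k) = 2 * k + 1 := rfl
    rw [this]; simp

theorem primrec_int_neg_toNat : Primrec fun z : ℤ => (-z).toNat := by
  have h : Primrec fun z : ℤ =>
      bif (Encodable.encode z).bodd then (Encodable.encode z).div2 + 1 else 0 :=
    Primrec.cond (Primrec.nat_bodd.comp Primrec.encode)
      (Primrec.succ.comp (Primrec.nat_div2.comp Primrec.encode)) (Primrec.const 0)
  refine h.of_eq fun z => ?_
  rcases z with k | k
  · have : Encodable.encode (Int.ofNat k) = 2 * k := rfl
    rw [this]; simp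
  · have : Encodable.encode (Int.negSucc k) = 2 * k + 1 := rfl
    rw [this]; simp [Int.neg_negSucc]

theorem primrec_int_natAbs : Primrec Int.natAbs :=
  (Primrec.nat_add.comp primrec_int_toNat primrec_int_neg_toNat).of_eq fun z => by omega

theorem primrec_nat_pow : Primrec₂ ((· ^ ·) : ℕ → ℕ → ℕ) :=
  Primrec₂.unpaired'.1 Nat.Primrec.pow

theorem primrec_nat_bits : Primrec Nat.bits := by
  -- Course-of-values recursion: the list holds the expansions of all smaller numbers, so its length
  -- is the current number and the entry at half the length supplies the higher digits.
  have hg : Primrec₂ fun (_ : Unit) (l : List (List Bool)) =>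
      if l.length = 0 then some []
      else (l[l.length.div2]?).map fun t => l.length.bodd :: t := by
    refine Primrec.ite (Primrec.eq.comp (Primrec.list_length.comp Primrec.snd) (Primrec.const 0))
      (Primrec.const _) ?_
    refine Primrec.option_map
      (Primrec.list_getElem?.comp Primrec.snd
        (Primrec.nat_div2.comp (Primrec.list_length.comp Primrec.snd))) ?_
    exact Primrec.list_cons.comp
      (Primrec.nat_bodd.comp (Primrec.list_length.comp (Primrec.snd.comp Primrec.fst)))
      Primrec.snd
  have := Primrec.nat_strong_rec (fun (_ : Unit) n => Nat.bits n) hg (by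
    intro _ n
    rcases Nat.eq_zero_or_pos n with rfl | hn
    · simp
    · have hlt : n.div2 < n := by rw [Nat.div2_val]; omega
      simp only [List.length_map, List.length_range, hn.ne', if_false]
      rw [List.getElem?_map, List.getElem?_range hlt]
      simp only [Option.map_some, Option.some.injEq]
      conv_rhs => rw [← Nat.bit_bodd_div2 n]
      rw [Nat.bits_append_bit]
      intro h0
      have := Nat.bodd_add_div2 n
      rw [h0] at this
      cases hb : n.bodd
      · rw [hb] at this; simp at this; omega
      · rfl)
  exact this.comp (Primrec.const ()) Primrec.id

theorem primrec_binaryCode {α : Type} [Primcodable α] : Primrec (binaryCode (α := α)) :=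
  primrec_nat_bits.comp Primrec.encode

theorem nat_bits_injective : Function.Injective Nat.bits := by
  intro a
  induction a using Nat.strong_induction_on with
  | _ a ih =>
    intro b h
    have h1 : a.bodd = b.bodd := by rw [Nat.bodd_eq_bits_head, Nat.bodd_eq_bits_head, h]
    have h2 : a.div2.bits = b.div2.bits := by
      rw [Nat.div2_bits_eq_tail, Nat.div2_bits_eq_tail, h]
    rcases Nat.eq_zero_or_pos a with rfl | ha
    · have := congrArg List.length h
      rw [Nat.size_eq_bits_len, Nat.size_eq_bits_len, Nat.size_zero] at this
      exact (Nat.size_eq_zero.1 this.symm).symm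
    · have h3 := ih a.div2 (by rw [Nat.div2_val]; omega) h2
      rw [← Nat.bit_bodd_div2 a, ← Nat.bit_bodd_div2 b, h1, h3]

theorem binaryCode_injective {α : Type} [Primcodable α] :
    Function.Injective (binaryCode (α := α)) :=
  nat_bits_injective.comp Encodable.encode_injective

/-- Every partial recursive function is the increasing limit of a primitive recursive
sequence of finite approximations. -/
theorem exists_primrec_stages {α σ : Type} [Primcodable α] [Primcodable σ] {f : α →. σ}
    (hf : Partrec f) :
    ∃ S : ℕ → α → Option σ, Primrec₂ S ∧
      (∀ s t a b, s ≤ t → S s a = some b → S t a = some b) ∧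
      ∀ a b, b ∈ f a ↔ ∃ t, S t a = some b := by
  obtain ⟨c, hc⟩ := Nat.Partrec.Code.exists_code.1 hf
  refine ⟨fun t a => (Nat.Partrec.Code.evaln t c (Encodable.encode a)).bind Encodable.decode,
    ?_, ?_, ?_⟩
  · refine Primrec.option_bind (Nat.Partrec.Code.primrec_evaln.comp
      (Primrec.pair (Primrec.pair Primrec.fst (Primrec.const c))
        (Primrec.encode.comp Primrec.snd))) (Primrec.decode.comp Primrec.snd)
  · intro s t a b hst h
    obtain ⟨x, hx, hb⟩ := Option.bind_eq_some_iff.1 h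
    exact Option.bind_eq_some_iff.2 ⟨x, Nat.Partrec.Code.evaln_mono hst hx, hb⟩
  · intro a b
    have key : ∀ x, x ∈ Nat.Partrec.Code.eval c (Encodable.encode a) ↔
        ∃ b ∈ f a, Encodable.encode b = x := by
      intro x; rw [hc]; simp
    constructor
    · intro hb
      obtain ⟨t, ht⟩ := Nat.Partrec.Code.evaln_complete.1 ((key _).2 ⟨b, hb, rfl⟩)
      exact ⟨t, Option.bind_eq_some_iff.2 ⟨_, ht, Encodable.encodek b⟩⟩
    · rintro ⟨t, h⟩
      obtain ⟨x, hx, hb⟩ := Option.bind_eq_some_iff.1 h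
      obtain ⟨y, hy, rfl⟩ := (key x).1 (Nat.Partrec.Code.evaln_sound hx)
      rw [Encodable.encodek] at hb
      exact Option.some.inj hb ▸ hy

/-! ### The Kraft inequality -/

/-- The first words of two factorizations are prefixes of the same string, hence comparable, hence
equal; cancel them and induct. -/
theorem uniquelyDecodable_of_prefixFree {α : Type*} {S : Set (List α)} (hnil : [] ∉ S)
    (h : ∀ u ∈ S, ∀ v ∈ S, u <+: v → u = v) : InformationTheory.UniquelyDecodable S := by
  intro L₁
  induction L₁ with
  | nil =>
    intro L₂ _ h₂ he
    cases L₂ with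
    | nil => rfl
    | cons b t =>
      simp only [List.flatten_nil, List.flatten_cons] at he
      have := (List.append_eq_nil_iff.1 he.symm).1
      exact absurd (this ▸ h₂ b (by simp)) hnil
  | cons a s ih =>
    intro L₂ h₁ h₂ he
    cases L₂ with
    | nil =>
      simp only [List.flatten_nil, List.flatten_cons] at he
      have := (List.append_eq_nil_iff.1 he).1
      exact absurd (this ▸ h₁ a (by simp)) hnil
    | cons b t =>
      simp only [List.flatten_cons] at he
      have hab : a = b := by
        rcases List.prefix_or_prefix_of_prefix (List.prefix_append a s.flatten)
          (he ▸ List.prefix_append b t.flatten) with hp | hp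
        · exact h a (h₁ a (by simp)) b (h₂ b (by simp)) hp
        · exact (h b (h₂ b (by simp)) a (h₁ a (by simp)) hp).symm
      subst hab
      rw [ih t (fun w hw => h₁ w (by simp [hw])) (fun w hw => h₂ w (by simp [hw]))
        (List.append_cancel_left he)]

theorem sum_le_one_of_prefixFree (T : Finset (List Bool))
    (h : ∀ u ∈ T, ∀ v ∈ T, u <+: v → u = v) : ∑ w ∈ T, (2⁻¹ : ℝ≥0∞) ^ w.length ≤ 1 := by
  -- A set containing the empty word is never uniquely decodable, so Kraft–McMillan does not apply
  -- to it; prefix-freeness leaves only `{[]}`, of weight 1.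
  by_cases hnil : [] ∈ T
  · have : T = {[]} := by
      ext v
      rw [Finset.mem_singleton]
      exact ⟨fun hv => (h [] hnil v hv List.nil_prefix).symm, fun hv => hv ▸ hnil⟩
    simp [this]
  · have h1 := InformationTheory.kraft_mcmillan_inequality
      (uniquelyDecodable_of_prefixFree (S := (T : Set (List Bool))) (by simpa using hnil)
        (by simpa using h))
    have h2 : (∑ w ∈ T, (2⁻¹ : ℝ≥0∞) ^ w.length) =
        ((∑ w ∈ T, (2⁻¹ : ℝ≥0) ^ w.length : ℝ≥0) : ℝ≥0∞) := by
      push_cast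
      rfl
    rw [h2, ← ENNReal.coe_one, ENNReal.coe_le_coe, ← NNReal.coe_le_coe]
    push_cast
    simpa using h1

open Classical in
theorem IsPrefixMachine.tsum_le_one {M : List Bool →. List Bool} (hM : IsPrefixMachine M) :
    ∑' π : List Bool, (if (M π).Dom then (2⁻¹ : ℝ≥0∞) ^ π.length else 0) ≤ 1 := by
  refine ENNReal.summable.tsum_le_of_sum_le fun T => ?_
  rw [← Finset.sum_filter]
  refine sum_le_one_of_prefixFree _ fun u hu v hv huv => ?_
  exact hM.prefixFree u v (Finset.mem_filter.1 hu).2 (Finset.mem_filter.1 hv).2 huv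

/-! ### Binary strings as dyadic intervals -/

/-- The number whose binary expansion, most significant digit first, is the given string. -/
def bitsValue (π : List Bool) : ℕ := π.foldl (fun v b => 2 * v + b.toNat) 0

theorem primrec_bitsValue : Primrec bitsValue :=
  Primrec.list_foldl (h := fun _ (x : ℕ × Bool) => 2 * x.1 + x.2.toNat) Primrec.id (Primrec.const 0)
    (Primrec.nat_add.comp (Primrec.nat_mul.comp (Primrec.const 2) (Primrec.fst.comp Primrec.snd))
      ((Primrec.dom_bool Bool.toNat).comp (Primrec.snd.comp Primrec.snd)))

theorem bitsValue_concat (π : List Bool) (b : Bool) :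
    bitsValue (π ++ [b]) = 2 * bitsValue π + b.toNat := by
  simp [bitsValue]

/-- This is the nesting of dyadic intervals under extension of strings, with denominators cleared.
-/
theorem bitsValue_append_bounds (π ρ : List Bool) :
    bitsValue π * 2 ^ ρ.length ≤ bitsValue (π ++ ρ) ∧
      bitsValue (π ++ ρ) + 1 ≤ (bitsValue π + 1) * 2 ^ ρ.length := by
  induction ρ using List.reverseRecOn with
  | nil => simp
  | append_singleton ρ b ih =>
    rw [← List.append_assoc, bitsValue_concat, List.length_append, List.length_singleton, pow_succ]
    have := Bool.toNat_le b
    constructor <;> nlinarith [ih.1, ih.2]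

theorem exists_bitsValue_eq {L x : ℕ} (hx : x < 2 ^ L) :
    ∃ π : List Bool, π.length = L ∧ bitsValue π = x := by
  induction L generalizing x with
  | zero => exact ⟨[], rfl, by simp at hx; simp [bitsValue, hx]⟩
  | succ L ih =>
    obtain ⟨π, h1, h2⟩ := ih (x := x / 2) (by rw [pow_succ] at hx; omega)
    refine ⟨π ++ [x.bodd], by simp [h1], ?_⟩
    rw [bitsValue_concat, h2, ← Nat.div2_val]
    have := Nat.bodd_add_div2 x
    omega

/-- The left end point of the dyadic interval of a string. -/
def intervalLeft (π : List Bool) : ℚ := bitsValue π / 2 ^ π.length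

/-- The right end point of the dyadic interval of a string. -/
def intervalRight (π : List Bool) : ℚ := (bitsValue π + 1) / 2 ^ π.length

theorem intervalLeft_lt_intervalRight (π : List Bool) : intervalLeft π < intervalRight π := by
  unfold intervalLeft intervalRight
  gcongr
  simp

theorem intervalLeft_mono {π π' : List Bool} (h : π <+: π') :
    intervalLeft π ≤ intervalLeft π' := by
  obtain ⟨ρ, rfl⟩ := h
  unfold intervalLeft
  rw [div_le_div_iff₀ (by positivity) (by positivity), List.length_append, pow_add]
  have : (bitsValue π : ℚ) * 2 ^ ρ.length ≤ bitsValue (π ++ ρ) := by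
    exact_mod_cast (bitsValue_append_bounds π ρ).1
  calc (bitsValue π : ℚ) * (2 ^ π.length * 2 ^ ρ.length)
      = (bitsValue π * 2 ^ ρ.length) * 2 ^ π.length := by ring
    _ ≤ _ := by gcongr

theorem intervalRight_anti {π π' : List Bool} (h : π <+: π') :
    intervalRight π' ≤ intervalRight π := by
  obtain ⟨ρ, rfl⟩ := h
  unfold intervalRight
  rw [div_le_div_iff₀ (by positivity) (by positivity), List.length_append, pow_add]
  have : (bitsValue (π ++ ρ) : ℚ) + 1 ≤ (bitsValue π + 1) * 2 ^ ρ.length := by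
    exact_mod_cast (bitsValue_append_bounds π ρ).2
  calc ((bitsValue (π ++ ρ) : ℚ) + 1) * 2 ^ π.length
      ≤ ((bitsValue π + 1) * 2 ^ ρ.length) * 2 ^ π.length := by gcongr
    _ = _ := by ring

/-! ### The machine built from a sequence of requests -/

/-- The weight of a request for a program of the given length. -/
def requestWeight : Option (ℕ × List Bool) → ℚ
  | none => 0
  | some p => (2⁻¹ : ℚ) ^ p.1

/-- The total weight of the requests before `i`, as a numerator and the exponent of a
denominator that is a power of two. -/
def allocated (e : ℕ → Option (ℕ × List Bool)) : ℕ → ℕ × ℕ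
  | 0 => (0, 0)
  | i + 1 => match e i with
    | none => allocated e i
    | some p => ((allocated e i).1 * 2 ^ p.1 + 2 ^ (allocated e i).2, (allocated e i).2 + p.1)

/-- The total weight of the requests before `i`. -/
def allocatedWeight (e : ℕ → Option (ℕ × List Bool)) (i : ℕ) : ℚ :=
  (allocated e i).1 / 2 ^ (allocated e i).2

/-- The value of a string of length `L` whose dyadic interval lies at or just after the
allocated part of the unit interval. -/
def nextValue (s : ℕ × ℕ) (L : ℕ) : ℕ := (s.1 * 2 ^ L + (2 ^ s.2 - 1)) / 2 ^ s.2

theorem primrec_allocated {e : ℕ → Option (ℕ × List Bool)} (he : Primrec e) :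
    Primrec (allocated e) := by
  have hp : Primrec fun x : (ℕ × ℕ × ℕ) × ℕ × List Bool => x.2.1 :=
    Primrec.fst.comp Primrec.snd
  have hN : Primrec fun x : (ℕ × ℕ × ℕ) × ℕ × List Bool => x.1.2.1 :=
    Primrec.fst.comp (Primrec.snd.comp Primrec.fst)
  have hE : Primrec fun x : (ℕ × ℕ × ℕ) × ℕ × List Bool => x.1.2.2 :=
    Primrec.snd.comp (Primrec.snd.comp Primrec.fst)
  have h2 := Primrec.const (α := (ℕ × ℕ × ℕ) × ℕ × List Bool) 2
  have hstep : Primrec₂ fun (i : ℕ) (s : ℕ × ℕ) =>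
      (Option.casesOn (e i) s
        (fun p : ℕ × List Bool => (s.1 * 2 ^ p.1 + 2 ^ s.2, s.2 + p.1)) : ℕ × ℕ) :=
    Primrec.option_casesOn (he.comp Primrec.fst) Primrec.snd
      (Primrec.pair
        (Primrec.nat_add.comp (Primrec.nat_mul.comp hN (primrec_nat_pow.comp h2 hp))
          (primrec_nat_pow.comp h2 hE))
        (Primrec.nat_add.comp hE hp))
  refine (Primrec.nat_rec₁ (0, 0) hstep).of_eq fun i => ?_
  induction i with
  | zero => rfl
  | succ i ih =>
    simp only [allocated, ← ih]
    cases e i <;> rfl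

theorem primrec_nextValue : Primrec₂ nextValue := by
  have h2 := Primrec.const (α := (ℕ × ℕ) × ℕ) 2
  have hN : Primrec fun x : (ℕ × ℕ) × ℕ => x.1.1 := Primrec.fst.comp Primrec.fst
  have hE : Primrec fun x : (ℕ × ℕ) × ℕ => 2 ^ x.1.2 :=
    primrec_nat_pow.comp h2 (Primrec.snd.comp Primrec.fst)
  exact Primrec.nat_div.comp
    (Primrec.nat_add.comp (Primrec.nat_mul.comp hN (primrec_nat_pow.comp h2 Primrec.snd))
      (Primrec.nat_sub.comp hE (Primrec.const 1))) hE

theorem allocatedWeight_succ (e : ℕ → Option (ℕ × List Bool)) (i : ℕ) :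
    allocatedWeight e (i + 1) = allocatedWeight e i + requestWeight (e i) := by
  unfold allocatedWeight
  cases h : e i with
  | none => simp [allocated, h, requestWeight]
  | some p =>
    simp only [allocated, h, requestWeight, inv_pow]
    push_cast
    rw [pow_add]
    field_simp

theorem allocatedWeight_eq_sum (e : ℕ → Option (ℕ × List Bool)) (i : ℕ) :
    allocatedWeight e i = ∑ j ∈ Finset.range i, requestWeight (e j) := by
  induction i with
  | zero => simp [allocatedWeight, allocated]
  | succ i ih => rw [allocatedWeight_succ, ih, Finset.sum_range_succ]

theorem allocatedWeight_mono (e : ℕ → Option (ℕ × List Bool)) : Monotone (allocatedWeight e) := by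
  refine monotone_nat_of_le_succ fun i => ?_
  rw [allocatedWeight_succ]
  have : 0 ≤ requestWeight (e i) := by
    cases e i <;> simp [requestWeight]
  linarith

/-- `nextValue` is the ceiling of `2 ^ L` times the allocated weight, so rounding skips less than
one cell of length `2 ^ (-L)`. -/
theorem nextValue_bounds (s : ℕ × ℕ) (L : ℕ) :
    (s.1 / 2 ^ s.2 : ℚ) ≤ nextValue s L / 2 ^ L ∧
      (nextValue s L / 2 ^ L : ℚ) < s.1 / 2 ^ s.2 + (2 ^ L)⁻¹ := by
  have hpos : 0 < 2 ^ s.2 := by positivity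
  have h := Nat.div_add_mod (s.1 * 2 ^ L + (2 ^ s.2 - 1)) (2 ^ s.2)
  have hm := Nat.mod_lt (s.1 * 2 ^ L + (2 ^ s.2 - 1)) hpos
  change 2 ^ s.2 * nextValue s L + _ = _ at h
  have h1 : s.1 * 2 ^ L ≤ nextValue s L * 2 ^ s.2 := by
    rw [mul_comm (nextValue s L)]; omega
  have h2 : nextValue s L * 2 ^ s.2 < s.1 * 2 ^ L + 2 ^ s.2 := by
    rw [mul_comm (nextValue s L)]; omega
  constructor
  · rw [div_le_div_iff₀ (by positivity) (by positivity)]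
    exact_mod_cast h1
  · have : (s.1 / 2 ^ s.2 + (2 ^ L)⁻¹ : ℚ) = (s.1 * 2 ^ L + 2 ^ s.2) / (2 ^ s.2 * 2 ^ L) := by
      field_simp
    rw [this, div_lt_div_iff₀ (by positivity) (by positivity)]
    have h3 : (nextValue s L * 2 ^ s.2 : ℚ) < s.1 * 2 ^ L + 2 ^ s.2 := by exact_mod_cast h2
    calc (nextValue s L : ℚ) * (2 ^ s.2 * 2 ^ L) = (nextValue s L * 2 ^ s.2) * 2 ^ L := by ring
      _ < _ := by gcongr

/-- The output of the request `i`, provided that `π` is the program allocated to it. -/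
def requestOutput (e : ℕ → Option (ℕ × List Bool)) (π : List Bool) (i : ℕ) :
    Option (List Bool) :=
  (e i).bind fun p =>
    if π.length = p.1 + 1 ∧ bitsValue π = nextValue (allocated e i) (p.1 + 1) then some p.2
    else none

theorem requestOutput_eq_some {e : ℕ → Option (ℕ × List Bool)} {π w : List Bool} {i : ℕ} :
    requestOutput e π i = some w ↔ ∃ ℓ, e i = some (ℓ, w) ∧ π.length = ℓ + 1 ∧
      bitsValue π = nextValue (allocated e i) (ℓ + 1) := by
  unfold requestOutput
  cases e i with
  | none => simp
  | some p =>
    obtain ⟨ℓ, v⟩ := p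
    simp only [Option.bind_some, Option.some.injEq, Prod.mk.injEq]
    constructor
    · intro h
      split_ifs at h with hc
      exact ⟨ℓ, ⟨rfl, Option.some.inj h⟩, hc⟩
    · rintro ⟨ℓ', ⟨rfl, rfl⟩, hc⟩
      rw [if_pos hc]

theorem primrec_requestOutput {e : ℕ → Option (ℕ × List Bool)} (he : Primrec e) :
    Primrec₂ (requestOutput e) := by
  have hL : Primrec fun x : (List Bool × ℕ) × ℕ × List Bool => x.2.1 + 1 :=
    Primrec.succ.comp (Primrec.fst.comp Primrec.snd)
  have hπ : Primrec fun x : (List Bool × ℕ) × ℕ × List Bool => x.1.1 :=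
    Primrec.fst.comp Primrec.fst
  have ha : Primrec fun x : (List Bool × ℕ) × ℕ × List Bool => allocated e x.1.2 :=
    (primrec_allocated he).comp (Primrec.snd.comp Primrec.fst)
  refine Primrec.option_bind (he.comp Primrec.snd) (Primrec.ite
    ((Primrec.eq.comp (Primrec.list_length.comp hπ) hL).and
      (Primrec.eq.comp (primrec_bitsValue.comp hπ) (primrec_nextValue.comp ha hL)))
    (Primrec.option_some.comp (Primrec.snd.comp Primrec.snd)) (Primrec.const none))

/-- Here the extra bit is spent. With a program of length `ℓ + 1`, rounding up wastes less than `2 ^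
(-(ℓ + 1))` and the interval occupies as much again, which together fit into the weight `2 ^ (-ℓ)`
of the request. -/
theorem requestOutput_interval {e : ℕ → Option (ℕ × List Bool)} {π w : List Bool} {i : ℕ}
    (h : requestOutput e π i = some w) :
    allocatedWeight e i ≤ intervalLeft π ∧ intervalRight π ≤ allocatedWeight e (i + 1) := by
  obtain ⟨ℓ, he, hl, hv⟩ := requestOutput_eq_some.1 h
  have hb := nextValue_bounds (allocated e i) (ℓ + 1)
  rw [allocatedWeight_succ, he, intervalLeft, intervalRight, hl, hv]
  refine ⟨hb.1, ?_⟩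
  rw [add_div]
  have h2 : (1 / 2 ^ (ℓ + 1) : ℚ) + (2 ^ (ℓ + 1))⁻¹ = requestWeight (some (ℓ, w)) := by
    simp only [requestWeight, inv_pow]; rw [pow_succ]; field_simp; norm_num
  have h3 : allocatedWeight e i =
      ((allocated e i).1 / 2 ^ (allocated e i).2 : ℚ) := rfl
  rw [← h2, h3]
  linarith [hb.2]

/-- Intervals of comparable strings are nested, whereas different requests own non-overlapping slots
of the unit interval; within one request the length of the program is fixed. -/
theorem requestOutput_prefixFree {e : ℕ → Option (ℕ × List Bool)} {π π' w w' : List Bool}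
    {i j : ℕ} (h : requestOutput e π i = some w) (h' : requestOutput e π' j = some w')
    (hp : π <+: π') : i = j ∧ π = π' := by
  obtain ⟨h1, h2⟩ := requestOutput_interval h
  obtain ⟨h1', h2'⟩ := requestOutput_interval h'
  have hij : i = j := by
    rcases lt_trichotomy i j with hlt | heq | hlt
    · have := allocatedWeight_mono e (Nat.succ_le_of_lt hlt)
      have := intervalRight_anti hp
      have := intervalLeft_lt_intervalRight π'
      rw [Nat.succ_eq_add_one] at *
      linarith
    · exact heq
    · have := allocatedWeight_mono e (Nat.succ_le_of_lt hlt)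
      have := intervalLeft_mono hp
      have := intervalLeft_lt_intervalRight π'
      rw [Nat.succ_eq_add_one] at *
      linarith
  subst hij
  obtain ⟨ℓ, he, hl, -⟩ := requestOutput_eq_some.1 h
  obtain ⟨ℓ', he', hl', -⟩ := requestOutput_eq_some.1 h'
  rw [he] at he'
  have : ℓ = ℓ' := congrArg Prod.fst (Option.some.inj he')
  exact ⟨rfl, hp.eq_of_length (by omega)⟩

/-- A primitive recursive sequence of requests of total weight at most one is served by a prefix
machine, at the cost of one extra bit. -/
theorem exists_prefixMachine_of_requests {e : ℕ → Option (ℕ × List Bool)} (he : Primrec e)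
    (hsum : ∀ i, ∑ j ∈ Finset.range i, requestWeight (e j) ≤ 1) :
    ∃ M : List Bool →. List Bool, IsPrefixMachine M ∧
      ∀ i ℓ w, e i = some (ℓ, w) → ∃ π, w ∈ M π ∧ π.length = ℓ + 1 := by
  refine ⟨fun π => Nat.rfindOpt (requestOutput e π),
    ⟨Partrec.rfindOpt (primrec_requestOutput he).to_comp, ?_⟩, ?_⟩
  · intro π π' h h' hp
    obtain ⟨i, w, hi⟩ := Nat.rfindOpt_dom.1 h
    obtain ⟨j, w', hj⟩ := Nat.rfindOpt_dom.1 h'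
    exact (requestOutput_prefixFree hi hj hp).2
  · intro i ℓ w hi
    -- The total weight is at most 1, so the left end point falls below 1 and is realized by a
    -- string.
    have hlt : nextValue (allocated e i) (ℓ + 1) < 2 ^ (ℓ + 1) := by
      have h1 := (nextValue_bounds (allocated e i) (ℓ + 1)).2
      have h2 := hsum (i + 1)
      rw [← allocatedWeight_eq_sum, allocatedWeight_succ, hi] at h2
      have h3 : (2 ^ (ℓ + 1) : ℚ)⁻¹ ≤ requestWeight (some (ℓ, w)) := by
        simp only [requestWeight, inv_pow]
        gcongr <;> norm_num
      have h4 : allocatedWeight e i =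
        ((allocated e i).1 / 2 ^ (allocated e i).2 : ℚ) := rfl
      have h5 : (nextValue (allocated e i) (ℓ + 1) / 2 ^ (ℓ + 1) : ℚ) < 1 := by linarith
      rw [div_lt_one (by positivity)] at h5
      exact_mod_cast h5
    obtain ⟨π, hl, hv⟩ := exists_bitsValue_eq hlt
    have hout : requestOutput e π i = some w := requestOutput_eq_some.2 ⟨ℓ, hi, hl, hv⟩
    refine ⟨π, ?_, hl⟩
    have hdom : (Nat.rfindOpt (requestOutput e π)).Dom := Nat.rfindOpt_dom.2 ⟨i, w, hout⟩
    -- The search may stop at another index `j`, but `π` is allocated to one request only.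
    obtain ⟨j, hj⟩ := Nat.rfindOpt_spec (Part.get_mem hdom)
    have hij := (requestOutput_prefixFree hout hj List.prefix_rfl).1
    subst hij
    have : (Nat.rfindOpt (requestOutput e π)).get hdom = w :=
      Option.some.inj (hj.symm.trans hout)
    exact this ▸ Part.get_mem hdom

/-! ### Complexity bounds from enumerable requests -/

theorem stringComplexity_le {U : List Bool →. List Bool} {π w : List Bool} (h : w ∈ U π) :
    stringComplexity U w ≤ π.length :=
  iInf₂_le π h

/-- If the infimum were not attained, every value would be at least the infimum plus one. -/
theorem exists_eq_biInf {ι : Type*} {p : ι → Prop} {v : ι → ℕ∞}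
    (h : ⨅ (i) (_ : p i), v i ≠ ⊤) : ∃ i, p i ∧ v i = ⨅ (i) (_ : p i), v i := by
  by_contra! hne
  have h1 : (⨅ (i) (_ : p i), v i) + 1 ≤ ⨅ (i) (_ : p i), v i :=
    le_iInf₂ fun i hi =>
      Order.add_one_le_of_lt (lt_of_le_of_ne (iInf₂_le i hi) (hne i hi).symm)
  exact absurd ((ENat.add_one_le_iff h).1 h1) (lt_irrefl _)

theorem exists_program {U : List Bool →. List Bool} {w : List Bool}
    (h : stringComplexity U w ≠ ⊤) : ∃ π, w ∈ U π ∧ (π.length : ℕ∞) = stringComplexity U w :=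
  exists_eq_biInf h

open Classical in
/-- The weights of an enumeration without repetitions add up to at most the weight of the
enumerated set. -/
theorem tsum_requestWeight_le {e : ℕ → Option (ℕ × List Bool)}
    (hinj : ∀ i j p, e i = some p → e j = some p → i = j) :
    ∑' i, (match e i with | none => 0 | some p => (2⁻¹ : ℝ≥0∞) ^ p.1) ≤
      ∑' p : ℕ × List Bool, if ∃ i, e i = some p then (2⁻¹ : ℝ≥0∞) ^ p.1 else 0 := by
  calc ∑' i, (match e i with | none => 0 | some p => (2⁻¹ : ℝ≥0∞) ^ p.1)
      ≤ ∑' i, ∑' p : ℕ × List Bool, if e i = some p then (2⁻¹ : ℝ≥0∞) ^ p.1 else 0 := by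
        refine ENNReal.tsum_le_tsum fun i => ?_
        cases h : e i with
        | none => simp
        | some p =>
          refine le_trans ?_ (ENNReal.le_tsum p)
          simp
    _ = ∑' p : ℕ × List Bool, ∑' i, if e i = some p then (2⁻¹ : ℝ≥0∞) ^ p.1 else 0 :=
        ENNReal.tsum_comm
    _ ≤ _ := by
        refine ENNReal.tsum_le_tsum fun p => ?_
        split_ifs with h
        · obtain ⟨i, hi⟩ := h
          rw [tsum_eq_single i]
          · simp [hi]
          · intro j hj
            rw [if_neg fun h => hj (hinj j i p h hi)]
        · rw [ENNReal.tsum_eq_zero.2]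
          intro i
          rw [if_neg fun hi => h ⟨i, hi⟩]

/-- A set of requests that is covered by a family of requests has at most its weight. -/
theorem tsum_requests_le {ι : Type*} {R : ℕ × List Bool → Prop} {V : ι → Prop}
    [DecidablePred R] [DecidablePred V] {g : ι → ℕ × List Bool}
    (h : ∀ p, R p → ∃ x, V x ∧ p = g x) :
    ∑' p : ℕ × List Bool, (if R p then (2⁻¹ : ℝ≥0∞) ^ p.1 else 0) ≤
      ∑' x, if V x then (2⁻¹ : ℝ≥0∞) ^ (g x).1 else 0 := by
  calc _ ≤ ∑' p : ℕ × List Bool, ∑' x,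
        (if p = g x then (if V x then (2⁻¹ : ℝ≥0∞) ^ (g x).1 else 0) else 0) := by
        refine ENNReal.tsum_le_tsum fun p => ?_
        split_ifs with hp
        · obtain ⟨x, hx, rfl⟩ := h p hp
          refine le_trans ?_ (ENNReal.le_tsum x)
          rw [if_pos rfl, if_pos hx]
        · exact zero_le
    _ = _ := by
        rw [ENNReal.tsum_comm]
        exact tsum_congr fun x => tsum_ite_eq _ _

open Classical in
/-- If the requests `p = (ℓ, w)` satisfying `∃ b, D p b` have finite total weight `∑ 2 ^ (-ℓ)`, then
the complexity of `w` is at most `ℓ` up to a constant. -/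
theorem exists_stringComplexity_le {U : List Bool →. List Bool} (hU : IsUniversalPrefixMachine U)
    {β : Type} [Primcodable β] {D : ℕ × List Bool → β → Prop} (hD : PrimrecRel D)
    (hsum : ∑' p : ℕ × List Bool, (if ∃ b, D p b then (2⁻¹ : ℝ≥0∞) ^ p.1 else 0) ≠ ⊤) :
    ∃ c : ℕ, ∀ p b, D p b → stringComplexity U p.2 ≤ (p.1 + c : ℕ) := by
  obtain ⟨c₀, hc₀⟩ : ∃ c₀ : ℕ, ∑' p : ℕ × List Bool,
      (if ∃ b, D p b then (2⁻¹ : ℝ≥0∞) ^ p.1 else 0) ≤ 2 ^ c₀ := by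
    obtain ⟨k, hk⟩ := ENNReal.exists_nat_gt hsum
    refine ⟨k, hk.le.trans ?_⟩
    exact_mod_cast Nat.lt_two_pow_self.le
  -- `e₀` lists the requests by decoding pairs of request and witness, `e₁` keeps only first
  -- occurrences so that no weight is counted twice, and `e` lengthens each request by `c₀`, which
  -- scales the total weight from at most `2 ^ c₀` to at most 1.
  let e₀ : ℕ → Option (ℕ × List Bool) := fun i =>
    (Encodable.decode (α := (ℕ × List Bool) × β) i).bind fun x =>
      if D x.1 x.2 then some x.1 else none
  let e₁ : ℕ → Option (ℕ × List Bool) := fun i => if ∃ j < i, e₀ j = e₀ i then none else e₀ i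
  let e : ℕ → Option (ℕ × List Bool) := fun i => (e₁ i).map fun p => (p.1 + c₀, p.2)
  have he₀ : Primrec e₀ := by
    refine Primrec.option_bind Primrec.decode (Primrec.ite ?_
      (Primrec.option_some.comp (Primrec.fst.comp Primrec.snd)) (Primrec.const none))
    exact hD.comp (Primrec.fst.comp Primrec.snd) (Primrec.snd.comp Primrec.snd)
  have he₁ : Primrec e₁ := by
    have h1 : PrimrecRel fun x y : ℕ => e₀ x = e₀ y :=
      Primrec.eq.comp (he₀.comp Primrec.fst) (he₀.comp Primrec.snd)
    exact Primrec.ite (h1.exists_lt.comp Primrec.id Primrec.id) (Primrec.const none) he₀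
  have he : Primrec e :=
    Primrec.option_map he₁ (Primrec.pair
      (Primrec.nat_add.comp (Primrec.fst.comp Primrec.snd) (Primrec.const c₀))
      (Primrec.snd.comp Primrec.snd))
  have e₁_some : ∀ i p, e₁ i = some p → e₀ i = some p ∧ ∀ j < i, e₀ j ≠ e₀ i := by
    intro i p h
    simp only [e₁] at h
    split_ifs at h with hc
    push Not at hc
    exact ⟨h, hc⟩
  have e₀_some : ∀ i p, e₀ i = some p → ∃ b, D p b := by
    intro i p h
    obtain ⟨x, -, hx⟩ := Option.bind_eq_some_iff.1 h
    split_ifs at hx with hc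
    exact ⟨x.2, Option.some.inj hx ▸ hc⟩
  have hinj : ∀ i j p, e₁ i = some p → e₁ j = some p → i = j := by
    intro i j p hi hj
    obtain ⟨hi1, hi2⟩ := e₁_some i p hi
    obtain ⟨hj1, hj2⟩ := e₁_some j p hj
    rcases lt_trichotomy i j with h | h | h
    · exact absurd (hi1.trans hj1.symm) (hj2 i h)
    · exact h
    · exact absurd (hj1.trans hi1.symm) (hi2 j h)
  have htotal : ∑' i, (match e₁ i with | none => 0 | some p => (2⁻¹ : ℝ≥0∞) ^ p.1) ≤ 2 ^ c₀ := by
    refine (tsum_requestWeight_le hinj).trans (le_trans ?_ hc₀)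
    refine ENNReal.tsum_le_tsum fun p => ?_
    by_cases h : ∃ i, e₁ i = some p
    · obtain ⟨i, hi⟩ := h
      rw [if_pos ⟨i, hi⟩, if_pos (e₀_some i p (e₁_some i p hi).1)]
    · rw [if_neg h]; exact zero_le
  have hle : ∀ i, ∑ j ∈ Finset.range i, requestWeight (e j) ≤ 1 := by
    intro i
    let w : ℕ → ℝ≥0 := fun j => match e₁ j with | none => 0 | some p => (2⁻¹ : ℝ≥0) ^ p.1
    have h1 : ∀ j, ((requestWeight (e j) : ℚ) : ℝ) = w j * (2 ^ c₀)⁻¹ := by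
      intro j
      simp only [e, w]
      cases e₁ j with
      | none => simp [requestWeight]
      | some p => simp [requestWeight, pow_add]
    have h2 : ((∑ j ∈ Finset.range i, w j : ℝ≥0) : ℝ≥0∞) ≤ ((2 ^ c₀ : ℝ≥0) : ℝ≥0∞) := by
      push_cast
      refine le_trans ?_ htotal
      refine le_trans (le_of_eq ?_) (ENNReal.sum_le_tsum (Finset.range i))
      refine Finset.sum_congr rfl fun j _ => ?_
      simp only [w]
      cases e₁ j with
      | none => simp
      | some p => push_cast; rfl
    rw [ENNReal.coe_le_coe, ← NNReal.coe_le_coe] at h2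
    push_cast at h2
    have h3 : ((∑ j ∈ Finset.range i, requestWeight (e j) : ℚ) : ℝ) ≤ 1 := by
      push_cast
      simp only [h1]
      rw [← Finset.sum_mul, ← div_eq_mul_inv, div_le_one (by positivity)]
      exact h2
    exact_mod_cast h3
  obtain ⟨M, hM, hserve⟩ := exists_prefixMachine_of_requests he hle
  obtain ⟨c, hc⟩ := hU.simulates M hM
  refine ⟨c₀ + 1 + c, fun p b hpb => ?_⟩
  have hex : ∃ i, e₀ i = some p :=
    ⟨Encodable.encode (p, b), by simp only [e₀, Encodable.encodek, Option.bind_some, if_pos hpb]⟩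
  -- The first index that lists `p` survives the removal of repetitions.
  have hfind : e₁ (Nat.find hex) = some p := by
    simp only [e₁]
    rw [if_neg]
    · exact Nat.find_spec hex
    · rintro ⟨j, hj, h⟩
      exact Nat.find_min hex hj (h.trans (Nat.find_spec hex))
  obtain ⟨π, hπ, hlen⟩ := hserve (Nat.find hex) (p.1 + c₀) p.2 (by simp [e, hfind])
  obtain ⟨π', hπ', hlen'⟩ := hc π p.2 hπ
  refine (stringComplexity_le hπ').trans ?_
  exact_mod_cast (by omega : π'.length ≤ p.1 + (c₀ + 1 + c))

/-- `K(r)` is at most twice the binary length of `r`, up to a constant. -/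
theorem exists_stringComplexity_bits_le {U : List Bool →. List Bool}
    (hU : IsUniversalPrefixMachine U) :
    ∃ c : ℕ, ∀ k : ℕ, stringComplexity U (Nat.bits k) ≤ (2 * k.size + c : ℕ) := by
  classical
  let D : ℕ × List Bool → ℕ → Prop := fun p k => p = (2 * (Nat.bits k).length, Nat.bits k)
  have hb : Primrec fun x : (ℕ × List Bool) × ℕ => Nat.bits x.2 :=
    primrec_nat_bits.comp Primrec.snd
  have hD : PrimrecRel D :=
    Primrec.eq.comp Primrec.fst (Primrec.pair
      (Primrec.nat_mul.comp (Primrec.const 2) (Primrec.list_length.comp hb)) hb)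
  have hsum : ∑' p : ℕ × List Bool, (if ∃ b, D p b then (2⁻¹ : ℝ≥0∞) ^ p.1 else 0) ≠ ⊤ := by
    -- Since `k + 1 ≤ 2 ^ size k`, a request of length `2 * size k` weighs at most `(k + 1) ^ (-2)`.
    have hs : Summable fun k : ℕ => (((k : ℝ≥0) + 1) ^ 2)⁻¹ := by
      rw [← NNReal.summable_coe]
      have h := (summable_nat_add_iff 1).2 (Real.summable_nat_pow_inv.2 one_lt_two)
      exact h.congr fun k => by push_cast; rfl
    refine ne_top_of_le_ne_top (ENNReal.tsum_coe_ne_top_iff_summable.2 hs) ?_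
    refine (tsum_requests_le (V := fun _ : ℕ => True) fun p ⟨k, hk⟩ => ⟨k, trivial, hk⟩).trans ?_
    refine ENNReal.tsum_le_tsum fun k => ?_
    have h1 : ((2⁻¹ : ℝ≥0∞) ^ (2 * (Nat.bits k).length)) =
        (((2⁻¹ : ℝ≥0) ^ (2 * (Nat.bits k).length) : ℝ≥0) : ℝ≥0∞) := by push_cast; rfl
    rw [if_pos trivial, h1, ENNReal.coe_le_coe, Nat.size_eq_bits_len, pow_mul', inv_pow, inv_pow]
    gcongr
    exact_mod_cast Nat.lt_size_self k
  obtain ⟨c, hc⟩ := exists_stringComplexity_le hU hD hsum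
  refine ⟨c, fun k => ?_⟩
  rw [← Nat.size_eq_bits_len]
  exact hc (2 * (Nat.bits k).length, Nat.bits k) k rfl

/-! ### Strong finiteness of `κ` -/

theorem ratCode_injective : Function.Injective ratCode := fun _ _ h =>
  Rat.ext (congrArg Prod.fst h) (congrArg Prod.snd h)

theorem pointCode_injective {n : ℕ} : Function.Injective (pointCode (n := n)) := fun _ _ h =>
  funext fun i => ratCode_injective (congrFun h i)

theorem ratPoint_injective {n : ℕ} : Function.Injective (ratPoint (n := n)) := by
  intro p q h
  funext i
  have h1 : (p i : ℝ) = q i := congrFun (congrArg WithLp.ofLp h) i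
  exact_mod_cast h1

theorem natComplexity_ne_top {U : List Bool →. List Bool} (hU : IsUniversalPrefixMachine U)
    (r : ℕ) : natComplexity U r ≠ ⊤ := by
  obtain ⟨c, hc⟩ := exists_stringComplexity_bits_le hU
  exact ne_top_of_le_ne_top (ENat.natCast_ne_top _) (hc (Encodable.encode r))

theorem pointComplexity_ne_top {U : List Bool →. List Bool} (hU : IsUniversalPrefixMachine U)
    {n : ℕ} (q : Fin n → ℚ) : pointComplexity U q ≠ ⊤ := by
  obtain ⟨c, hc⟩ := exists_stringComplexity_bits_le hU
  exact ne_top_of_le_ne_top (ENat.natCast_ne_top _)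
    (hc (@Encodable.encode _ Primcodable.toEncodable (pointCode q)))

theorem kappa_apply (U : List Bool →. List Bool) {n : ℕ} (E : Set (EuclideanSpace ℝ (Fin n))) :
    kappa U n E = (twoPowNeg (setComplexity U E) : ℝ≥0∞) := rfl

theorem coe_twoPowNeg (k : ℕ) : ((twoPowNeg k : ℝ≥0) : ℝ≥0∞) = (2⁻¹ : ℝ≥0∞) ^ k := by
  rw [twoPowNeg_coe]; push_cast; rfl

/-- A family of shortest programs for the rational points. -/
theorem exists_shortest_programs {U : List Bool →. List Bool} (hU : IsUniversalPrefixMachine U)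
    (n : ℕ) : ∃ π : (Fin n → ℚ) → List Bool, Function.Injective π ∧
      ∀ q, binaryCode (pointCode q) ∈ U (π q) ∧ ((π q).length : ℕ∞) = pointComplexity U q := by
  choose π hπ using fun q : Fin n → ℚ => exists_program (pointComplexity_ne_top hU q)
  refine ⟨π, fun p q h => ?_, hπ⟩
  have h1 := (hπ p).1
  rw [h] at h1
  exact pointCode_injective (binaryCode_injective (Part.mem_unique h1 (hπ q).1))

theorem pointComplexity_le_setComplexity_singleton (U : List Bool →. List Bool) {n : ℕ}
    (q : Fin n → ℚ) : pointComplexity U q ≤ setComplexity U {ratPoint q} :=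
  le_iInf₂ fun _ hp => le_of_eq (congrArg _ (ratPoint_injective hp).symm)

/-- Choosing shortest programs embeds the rational points into the domain of `U`, so the point
masses sum to at most 1 by Kraft's inequality. -/
theorem isStronglyFinite_kappa {U : List Bool →. List Bool} (hU : IsUniversalPrefixMachine U)
    (n : ℕ) : IsStronglyFinite (kappa U n) := by
  classical
  constructor
  · have : setComplexity U (Set.range (ratPoint (n := n)))ᶜ = ⊤ := by
      simp [setComplexity]
    rw [IsSupportedOnRat, kappa_apply, this, twoPowNeg_top, ENNReal.coe_zero]
  · obtain ⟨π, hinj, hπ⟩ := exists_shortest_programs hU n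
    refine lt_of_le_of_lt ?_ ENNReal.one_lt_top
    refine le_trans ?_ hU.isPrefixMachine.tsum_le_one
    refine le_trans ?_ (ENNReal.tsum_comp_le_tsum_of_injective hinj _)
    refine ENNReal.tsum_le_tsum fun q => ?_
    rw [if_pos (Part.dom_iff_mem.2 ⟨_, (hπ q).1⟩), ← coe_twoPowNeg, (hπ q).2, kappa_apply]
    exact ENNReal.coe_le_coe.2
      (twoPowNeg_antitone (pointComplexity_le_setComplexity_singleton U q))

/-! ### Lower semicomputability of `κ` -/

theorem finite_pointComplexity_le {U : List Bool →. List Bool} (hU : IsUniversalPrefixMachine U)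
    (n k : ℕ) : {q : Fin n → ℚ | pointComplexity U q ≤ k}.Finite := by
  obtain ⟨π, hinj, hπ⟩ := exists_shortest_programs hU n
  refine Set.Finite.of_injOn (f := π) (t := {l : List Bool | l.length ≤ k}) (fun q hq => ?_)
    hinj.injOn (List.finite_length_le Bool k)
  have h : ((π q).length : ℕ∞) ≤ k := (hπ q).2 ▸ hq
  exact_mod_cast h

/-- Off the finite set of points of complexity at most `k`, the mass is at most `2 ^ (-k)`. -/
theorem isFinitelySupportedOnRat_kappa {U : List Bool →. List Bool}
    (hU : IsUniversalPrefixMachine U) (n : ℕ) : IsFinitelySupportedOnRat (kappa U n) := by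
  intro ε hε
  obtain ⟨k, hk⟩ := exists_pow_lt_of_lt_one hε (by norm_num [inv_lt_one_iff₀] : (2⁻¹ : ℝ≥0) < 1)
  refine ⟨(finite_pointComplexity_le hU n k).toFinset, ?_⟩
  rw [kappa_apply, ENNReal.coe_lt_coe]
  refine lt_of_le_of_lt ?_ hk
  rw [← twoPowNeg_coe]
  refine twoPowNeg_antitone (le_iInf₂ fun q hq => ?_)
  by_contra! hlt
  exact hq ⟨q, by simpa using hlt.le, rfl⟩

/-- At stage `t`, some program of length `k` is seen to print the code of a member of `l`. -/
def PrintedAt {n : ℕ} (S : ℕ → List Bool → Option (List Bool)) (l : List (Fin n → ℤ × ℕ))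
    (t k : ℕ) : Prop :=
  ∃ π ∈ (List.range t).filterMap (Encodable.decode (α := List Bool)),
    ∃ p ∈ l, π.length = k ∧ S t π = some (binaryCode p)

theorem primrecPred_printedAt {n : ℕ} {S : ℕ → List Bool → Option (List Bool)} (hS : Primrec₂ S) :
    PrimrecPred fun x : List (Fin n → ℤ × ℕ) × ℕ × ℕ => PrintedAt S x.1 x.2.1 x.2.2 := by
  have h₁ : PrimrecRel fun (p : Fin n → ℤ × ℕ) (x : List Bool × ℕ × ℕ) =>
      x.1.length = x.2.2 ∧ S x.2.1 x.1 = some (binaryCode p) := by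
    refine PrimrecPred.and ?_ ?_
    · exact Primrec.eq.comp (Primrec.list_length.comp (Primrec.fst.comp Primrec.snd))
        (Primrec.snd.comp (Primrec.snd.comp Primrec.snd))
    · exact Primrec.eq.comp
        (hS.comp (Primrec.fst.comp (Primrec.snd.comp Primrec.snd)) (Primrec.fst.comp Primrec.snd))
        (Primrec.option_some.comp (primrec_binaryCode.comp Primrec.fst))
  have h₂ : PrimrecRel fun (π : List Bool) (y : List (Fin n → ℤ × ℕ) × ℕ × ℕ) =>
      ∃ p ∈ y.1, π.length = y.2.2 ∧ S y.2.1 π = some (binaryCode p) :=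
    h₁.exists_mem_list.comp (Primrec.fst.comp Primrec.snd)
      (Primrec.pair Primrec.fst (Primrec.snd.comp Primrec.snd))
  have h₃ : Primrec fun x : List (Fin n → ℤ × ℕ) × ℕ × ℕ =>
      (List.range x.2.1).filterMap (Encodable.decode (α := List Bool)) :=
    Primrec.listFilterMap (Primrec.list_range.comp (Primrec.fst.comp Primrec.snd))
      (Primrec.decode.comp Primrec.snd)
  exact h₂.exists_mem_list.comp h₃ Primrec.id

theorem PrintedAt.mono {n : ℕ} {S : ℕ → List Bool → Option (List Bool)}
    (hS : ∀ s t a b, s ≤ t → S s a = some b → S t a = some b) {l l' : List (Fin n → ℤ × ℕ)}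
    (hl : l ⊆ l') {s t k : ℕ} (hst : s ≤ t) (h : PrintedAt S l s k) : PrintedAt S l' t k := by
  obtain ⟨π, hπ, p, hp, hlen, hSp⟩ := h
  refine ⟨π, ?_, p, hl hp, hlen, hS s t _ _ hst hSp⟩
  obtain ⟨x, hx, hd⟩ := List.mem_filterMap.1 hπ
  exact List.mem_filterMap.2 ⟨x, List.mem_range.2 ((List.mem_range.1 hx).trans_le hst), hd⟩

open Classical in
/-- The least length of a program seen at stage `t` to print the code of a member of `l`; it is
`t + 1` if there is none of length at most `t`. -/
noncomputable def stageComplexity {n : ℕ} (S : ℕ → List Bool → Option (List Bool))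
    (l : List (Fin n → ℤ × ℕ)) (t : ℕ) : ℕ :=
  (List.range (t + 1)).findIdx fun k => decide (PrintedAt S l t k)

theorem primrec_stageComplexity {n : ℕ} {S : ℕ → List Bool → Option (List Bool)}
    (hS : Primrec₂ S) : Primrec₂ (stageComplexity (n := n) S) := by
  classical
  refine Primrec.list_findIdx (Primrec.list_range.comp (Primrec.succ.comp Primrec.snd)) ?_
  exact ((primrecPred_printedAt hS).comp (Primrec.pair (Primrec.fst.comp Primrec.fst)
    (Primrec.pair (Primrec.snd.comp Primrec.fst) Primrec.snd))).decide

theorem printedAt_stageComplexity {n : ℕ} {S : ℕ → List Bool → Option (List Bool)}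
    {l : List (Fin n → ℤ × ℕ)} {t : ℕ} (h : stageComplexity S l t ≤ t) :
    PrintedAt S l t (stageComplexity S l t) := by
  classical
  have h1 : (List.range (t + 1)).findIdx (fun k => decide (PrintedAt S l t k)) <
      (List.range (t + 1)).length := by
    rw [List.length_range]; exact Nat.lt_succ_of_le h
  have h2 := List.findIdx_getElem (w := h1)
  rw [List.getElem_range] at h2
  exact of_decide_eq_true h2

theorem stageComplexity_le {n : ℕ} {S : ℕ → List Bool → Option (List Bool)}
    {l : List (Fin n → ℤ × ℕ)} {t k : ℕ} (h : PrintedAt S l t k) :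
    stageComplexity S l t ≤ k := by
  classical
  by_contra! hlt
  have h1 := List.not_of_lt_findIdx hlt
  rw [List.getElem_range] at h1
  simp [h] at h1

/-- Lets the algorithm work on an arbitrary listing of a finite set, with repetitions allowed. -/
theorem stageComplexity_congr {n : ℕ} {S : ℕ → List Bool → Option (List Bool)}
    {l l' : List (Fin n → ℤ × ℕ)} (h : ∀ p, p ∈ l ↔ p ∈ l') (t : ℕ) :
    stageComplexity S l t = stageComplexity S l' t := by
  have h' : ∀ k, PrintedAt S l t k ↔ PrintedAt S l' t k := fun k => by
    unfold PrintedAt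
    simp only [h]
  exact congrArg (fun p => List.findIdx p _) (funext fun k => decide_eq_decide.2 (h' k))

theorem ratCode_two_pow_inv (k : ℕ) : ratCode (((2 : ℚ) ^ k)⁻¹) = (1, 2 ^ k) := by
  have h : ((2 : ℚ) ^ k)⁻¹ = (((2 ^ k : ℕ) : ℚ))⁻¹ := by push_cast; rfl
  rw [h, ratCode, Rat.inv_natCast_num_of_pos (by positivity),
    Rat.inv_natCast_den_of_pos (by positivity)]

theorem isLowerSemicomputable_kappa {U : List Bool →. List Bool}
    (hU : IsUniversalPrefixMachine U) (n : ℕ) : IsLowerSemicomputable (kappa U n) := by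
  classical
  refine ⟨isFinitelySupportedOnRat_kappa hU n, ?_⟩
  obtain ⟨S, hS, hmono, hlim⟩ := exists_primrec_stages hU.isPrefixMachine.partrec
  let h : Finset (Fin n → ℚ) → ℕ → ℕ := fun A t =>
    stageComplexity S (A.toList.map pointCode) t
  -- When no program has been seen, the search returns `t + 1`, and the lower bound must then be 0.
  let f : Finset (Fin n → ℚ) → ℕ → ℚ≥0 := fun A t => if h A t ≤ t then (2 ^ h A t)⁻¹ else 0
  have hf_pos : ∀ A t, h A t ≤ t → ((f A t : ℝ≥0) : ℝ≥0∞) = twoPowNeg (h A t) := by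
    intro A t ht
    simp only [f, if_pos ht]
    rw [twoPowNeg_coe, inv_pow]
    push_cast
    rfl
  have hf_neg : ∀ A t, ¬ h A t ≤ t → f A t = 0 := fun A t ht => if_neg ht
  have hle : ∀ A t, ((f A t : ℝ≥0) : ℝ≥0∞) ≤ kappa U n (ratPoint '' (A : Set (Fin n → ℚ))) := by
    intro A t
    by_cases ht : h A t ≤ t
    · rw [hf_pos A t ht, kappa_apply, ENNReal.coe_le_coe]
      refine twoPowNeg_antitone ?_
      obtain ⟨π, -, p, hp, hlen, hSp⟩ := printedAt_stageComplexity ht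
      obtain ⟨q, hq, rfl⟩ := List.mem_map.1 hp
      have h1 : setComplexity U (ratPoint '' (A : Set (Fin n → ℚ))) ≤ pointComplexity U q :=
        iInf₂_le q ⟨q, by simpa using hq, rfl⟩
      refine h1.trans ((stringComplexity_le ((hlim _ _).2 ⟨t, hSp⟩)).trans ?_)
      rw [hlen]
    · rw [hf_neg A t ht]; simp
  refine ⟨f, ⟨fun l t => if stageComplexity S l t ≤ t then (1, 2 ^ stageComplexity S l t)
    else (0, 1), ?_, ?_⟩, ?_, ?_⟩
  · have hs := primrec_stageComplexity (n := n) hS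
    refine Primrec.to_comp (Primrec.ite (Primrec.nat_le.comp hs Primrec.snd)
      (Primrec.pair (Primrec.const 1) (primrec_nat_pow.comp (Primrec.const 2) hs))
      (Primrec.const (0, 1)))
  · intro l t
    have hc : stageComplexity S (l.map pointCode) t = h l.toFinset t :=
      stageComplexity_congr (by simp) t
    simp only [hc, f]
    split_ifs with ht
    · push_cast
      exact (ratCode_two_pow_inv _).symm
    · rfl
  · refine fun A s t hst => ⟨?_, hle A t⟩
    by_cases hs : h A s ≤ s
    · have h1 : h A t ≤ h A s := stageComplexity_le
        ((printedAt_stageComplexity hs).mono hmono (List.Subset.refl _) hst)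
      simp only [f, if_pos hs, if_pos (h1.trans (hs.trans hst))]
      gcongr
      norm_num
    · rw [hf_neg A s hs]; exact zero_le
  · intro A
    by_cases htop : setComplexity U (ratPoint '' (A : Set (Fin n → ℚ))) = ⊤
    · have h0 : kappa U n (ratPoint '' (A : Set (Fin n → ℚ))) = 0 := by
        rw [kappa_apply, htop, twoPowNeg_top, ENNReal.coe_zero]
      rw [h0]
      exact tendsto_const_nhds.congr fun t =>
        (le_antisymm ((hle A t).trans h0.le) zero_le).symm
    · obtain ⟨q, hq, hqK⟩ := exists_eq_biInf htop
      obtain ⟨q', hq', hqq⟩ := hq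
      obtain rfl := ratPoint_injective hqq
      obtain ⟨π, hπ, hlen⟩ := exists_program (pointComplexity_ne_top hU q')
      obtain ⟨t₀, ht₀⟩ := (hlim _ _).1 hπ
      refine tendsto_const_nhds.congr' ?_
      -- From here on the shortest program has produced its output, its length is within the
      -- searched range, and its code is among those tried.
      filter_upwards [eventually_ge_atTop t₀, eventually_ge_atTop π.length,
        eventually_gt_atTop (Encodable.encode π)] with t h1 h2 h3
      have hpr : PrintedAt S (A.toList.map pointCode) t π.length :=
        ⟨π, List.mem_filterMap.2 ⟨_, List.mem_range.2 h3, Encodable.encodek π⟩, pointCode q',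
          List.mem_map.2 ⟨q', by simpa using hq', rfl⟩, rfl, hmono _ _ _ _ h1 ht₀⟩
      have h4 : h A t ≤ π.length := stageComplexity_le hpr
      refine le_antisymm ?_ (hle A t)
      rw [hf_pos A t (h4.trans h2), kappa_apply, ENNReal.coe_le_coe]
      refine twoPowNeg_antitone ?_
      have h5 : ((h A t : ℕ) : ℕ∞) ≤ π.length := by exact_mod_cast h4
      refine h5.trans ?_
      rw [hlen]
      exact hqK.le

/-! ### Deciding membership of rational points in dyadic cubes -/

theorem primrecPred_forall_fin {α : Type} [Primcodable α] {n : ℕ} {R : Fin n → α → Prop}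
    (h : ∀ i, PrimrecPred (R i)) : PrimrecPred fun a => ∀ i, R i a := by
  induction n with
  | zero =>
    exact (Primrec.eq.comp (Primrec.const (α := α) ()) (Primrec.const ())).of_eq fun a => by simp
  | succ n ih =>
    exact ((h 0).and (ih fun i => h i.succ)).of_eq fun a =>
      (Fin.forall_fin_succ (P := fun i => R i a)).symm

/-- Splitting integers into positive and negative parts and moving the negative ones across turns
this into a comparison of natural numbers. -/
theorem primrecPred_int_mul_add_le {α : Type} [Primcodable α] {a c : α → ℤ} {b d e : α → ℕ}
    (ha : Primrec a) (hb : Primrec b) (hc : Primrec c) (hd : Primrec d) (he : Primrec e) :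
    PrimrecPred fun x => a x * b x + e x ≤ c x * d x := by
  have h : PrimrecPred fun x => (a x).toNat * b x + (-c x).toNat * d x + e x ≤
      (c x).toNat * d x + (-a x).toNat * b x :=
    Primrec.nat_le.comp
      (Primrec.nat_add.comp (Primrec.nat_add.comp
        (Primrec.nat_mul.comp (primrec_int_toNat.comp ha) hb)
        (Primrec.nat_mul.comp (primrec_int_neg_toNat.comp hc) hd)) he)
      (Primrec.nat_add.comp
        (Primrec.nat_mul.comp (primrec_int_toNat.comp hc) hd)
        (Primrec.nat_mul.comp (primrec_int_neg_toNat.comp ha) hb))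
  refine h.of_eq fun x => ?_
  zify
  rw [← sub_nonneg, ← sub_nonneg (a := c x * d x)]
  conv_rhs => rw [← Int.toNat_sub_toNat_neg (a x), ← Int.toNat_sub_toNat_neg (c x)]
  refine iff_of_eq (congrArg _ ?_)
  ring

/-- When `b x ≠ 0`, it suffices to test the finitely many candidate divisors up to `b x`. -/
theorem primrecPred_coprime {α : Type} [Primcodable α] {a b : α → ℕ}
    (ha : Primrec a) (hb : Primrec b) :
    PrimrecPred fun x => b x ≠ 0 ∧ Nat.Coprime (a x) (b x) := by
  have h : PrimrecRel fun (d : ℕ) (x : ℕ × ℕ) =>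
      ¬ (x.1 % d = 0) ∨ ¬ (x.2 % d = 0) ∨ d = 1 := by
    refine PrimrecPred.or (PrimrecPred.not ?_) (PrimrecPred.or (PrimrecPred.not ?_) ?_)
    · exact Primrec.eq.comp (Primrec.nat_mod.comp (Primrec.fst.comp Primrec.snd) Primrec.fst)
        (Primrec.const 0)
    · exact Primrec.eq.comp (Primrec.nat_mod.comp (Primrec.snd.comp Primrec.snd) Primrec.fst)
        (Primrec.const 0)
    · exact Primrec.eq.comp Primrec.fst (Primrec.const 1)
  have h0 : PrimrecPred fun x => ¬ b x = 0 := (Primrec.eq.comp hb (Primrec.const 0)).not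
  refine (h0.and (h.forall_mem_list.comp (Primrec.list_range.comp (Primrec.succ.comp hb))
    (Primrec.pair ha hb))).of_eq fun x => and_congr_right fun hx => ?_
  simp only [List.mem_range, ← Nat.dvd_iff_mod_eq_zero]
  constructor
  · intro hall
    refine Nat.Coprime.symm (Nat.coprime_of_dvd' fun k hk hkb hka => ?_)
    have := hall k (Nat.lt_succ_of_le (Nat.le_of_dvd (Nat.pos_of_ne_zero hx) hkb))
    simp only [hka, hkb, not_true_eq_false, false_or] at this
    rw [this]
  · intro hc d _
    by_cases h1 : d ∣ a x
    · by_cases h2 : d ∣ b x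
      · exact Or.inr (Or.inr (Nat.eq_one_of_dvd_coprimes hc h1 h2))
      · exact Or.inr (Or.inl h2)
    · exact Or.inl h1

/-- `p` is the code of a rational number `q` with `m ≤ 2 ^ r * q < m + 1`. -/
def IsCodeInInterval (r : ℕ) (m : ℤ) (p : ℤ × ℕ) : Prop :=
  (p.2 ≠ 0 ∧ Nat.Coprime p.1.natAbs p.2) ∧
    m * p.2 + (0 : ℕ) ≤ p.1 * (2 ^ r : ℕ) ∧ ¬ m * p.2 + p.2 ≤ p.1 * (2 ^ r : ℕ)

/-- `p` is the code of the rational number `m / 2 ^ r`. -/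
def IsCodeOfDyadic (r : ℕ) (m : ℤ) (p : ℤ × ℕ) : Prop :=
  (p.2 ≠ 0 ∧ Nat.Coprime p.1.natAbs p.2) ∧
    m * p.2 + (0 : ℕ) ≤ p.1 * (2 ^ r : ℕ) ∧ p.1 * (2 ^ r : ℕ) + (0 : ℕ) ≤ m * p.2

theorem primrecPred_isCodeInInterval {α : Type} [Primcodable α] {r : α → ℕ} {m : α → ℤ}
    {p : α → ℤ × ℕ} (hr : Primrec r) (hm : Primrec m) (hp : Primrec p) :
    PrimrecPred fun x => IsCodeInInterval (r x) (m x) (p x) := by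
  have h1 := Primrec.fst.comp hp
  have h2 := Primrec.snd.comp hp
  have h3 := primrec_nat_pow.comp (Primrec.const 2) hr
  exact (primrecPred_coprime (primrec_int_natAbs.comp h1) h2).and
    ((primrecPred_int_mul_add_le hm h2 h1 h3 (Primrec.const 0)).and
      (primrecPred_int_mul_add_le hm h2 h1 h3 h2).not)

theorem primrecPred_isCodeOfDyadic {α : Type} [Primcodable α] {r : α → ℕ} {m : α → ℤ}
    {p : α → ℤ × ℕ} (hr : Primrec r) (hm : Primrec m) (hp : Primrec p) :
    PrimrecPred fun x => IsCodeOfDyadic (r x) (m x) (p x) := by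
  have h1 := Primrec.fst.comp hp
  have h2 := Primrec.snd.comp hp
  have h3 := primrec_nat_pow.comp (Primrec.const 2) hr
  exact (primrecPred_coprime (primrec_int_natAbs.comp h1) h2).and
    ((primrecPred_int_mul_add_le hm h2 h1 h3 (Primrec.const 0)).and
      (primrecPred_int_mul_add_le h1 h3 hm h2 (Primrec.const 0)))

theorem exists_ratCode_eq {p : ℤ × ℕ} (h : p.2 ≠ 0 ∧ Nat.Coprime p.1.natAbs p.2) :
    ∃ q : ℚ, ratCode q = p :=
  ⟨⟨p.1, p.2, h.1, h.2⟩, rfl⟩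

theorem mul_den_le_iff (q : ℚ) (r : ℕ) (m : ℤ) :
    m * q.den ≤ q.num * (2 ^ r : ℕ) ↔ (m : ℚ) ≤ q * 2 ^ r := by
  have hd : (0 : ℚ) < q.den := by exact_mod_cast q.den_pos
  have hq : q * 2 ^ r = q.num * 2 ^ r / q.den := by
    conv_lhs => rw [← Rat.num_div_den q]
    ring
  rw [hq, le_div_iff₀ hd]
  exact_mod_cast Iff.rfl

theorem le_mul_den_iff (q : ℚ) (r : ℕ) (m : ℤ) :
    q.num * (2 ^ r : ℕ) ≤ m * q.den ↔ q * 2 ^ r ≤ m := by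
  have hd : (0 : ℚ) < q.den := by exact_mod_cast q.den_pos
  have hq : q * 2 ^ r = q.num * 2 ^ r / q.den := by
    conv_lhs => rw [← Rat.num_div_den q]
    ring
  rw [hq, div_le_iff₀ hd]
  exact_mod_cast Iff.rfl

theorem isCodeInInterval_ratCode (r : ℕ) (m : ℤ) (q : ℚ) :
    IsCodeInInterval r m (ratCode q) ↔ (m : ℚ) ≤ q * 2 ^ r ∧ q * 2 ^ r < m + 1 := by
  have h1 := mul_den_le_iff q r m
  have h2 := mul_den_le_iff q r (m + 1)
  rw [add_mul, one_mul] at h2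
  push_cast at h2
  simp only [IsCodeInInterval, ratCode, Nat.cast_zero, add_zero]
  rw [h1, ← not_le (a := (m : ℚ) + 1), ← h2]
  push_cast
  exact and_iff_right ⟨q.den_nz, q.reduced⟩

/-- The inequalities fix the rational and reducedness fixes the pair. The code of a corner can thus
be recognized by a decidable test, without computing a reduced fraction. -/
theorem isCodeOfDyadic_iff (r : ℕ) (m : ℤ) (p : ℤ × ℕ) :
    IsCodeOfDyadic r m p ↔ p = ratCode (m / 2 ^ r) := by
  have key : ∀ q : ℚ, IsCodeOfDyadic r m (ratCode q) ↔ q = m / 2 ^ r := by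
    intro q
    rw [eq_div_iff (by positivity), le_antisymm_iff, ← mul_den_le_iff, ← le_mul_den_iff]
    simp only [IsCodeOfDyadic, ratCode, Nat.cast_zero, add_zero]
    rw [and_iff_right ⟨q.den_nz, q.reduced⟩, and_comm]
  constructor
  · intro h
    obtain ⟨q, rfl⟩ := exists_ratCode_eq h.1
    rw [(key q).1 h]
  · rintro rfl
    exact (key _).2 rfl

theorem mem_dyadicCube {n r : ℕ} {m : Fin n → ℤ} {x : EuclideanSpace ℝ (Fin n)} :
    x ∈ dyadicCube r m ↔ ∀ i, (m i : ℝ) ≤ x i * 2 ^ r ∧ x i * 2 ^ r < m i + 1 := by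
  have hpos : (2 : ℝ) ^ r ≠ 0 := by positivity
  constructor
  · rintro ⟨y, hy, rfl⟩ i
    have : (((2 : ℝ) ^ r)⁻¹ • y) i * 2 ^ r = y i := by
      simp only [PiLp.smul_apply, smul_eq_mul]; field_simp
    rw [this]
    exact hy i
  · intro h
    refine ⟨(2 : ℝ) ^ r • x, fun i => ?_, by simp [smul_smul, hpos]⟩
    simpa [mul_comm] using h i

theorem ratPoint_mem_dyadicCube {n r : ℕ} {m : Fin n → ℤ} {q : Fin n → ℚ} :
    ratPoint q ∈ dyadicCube r m ↔ ∀ i, (m i : ℚ) ≤ q i * 2 ^ r ∧ q i * 2 ^ r < m i + 1 := by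
  rw [mem_dyadicCube]
  refine forall_congr' fun i => and_congr ?_ ?_
  · change (m i : ℝ) ≤ (q i : ℝ) * 2 ^ r ↔ _
    exact_mod_cast Iff.rfl
  · change (q i : ℝ) * 2 ^ r < (m i : ℝ) + 1 ↔ _
    exact_mod_cast Iff.rfl

/-- The least corner of a dyadic cube. -/
def cubeCorner {n : ℕ} (r : ℕ) (m : Fin n → ℤ) : Fin n → ℚ := fun i => m i / 2 ^ r

theorem cubeCorner_mem {n : ℕ} (r : ℕ) (m : Fin n → ℤ) :
    ratPoint (cubeCorner r m) ∈ dyadicCube r m := by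
  rw [ratPoint_mem_dyadicCube]
  intro i
  have : cubeCorner r m i * 2 ^ r = m i := by
    unfold cubeCorner; field_simp
  rw [this]
  simp

/-- All members of the list are codes of rational points of the cube. -/
def AreCodesInCube {n : ℕ} (r : ℕ) (m : Fin n → ℤ) (l : List (Fin n → ℤ × ℕ)) : Prop :=
  ∀ p ∈ l, ∀ i, IsCodeInInterval r (m i) (p i)

/-- The coprimality test rejects pairs that encode no rational; this matters because the algorithm
for `ν` is specified only on lists of genuine codes. -/
theorem areCodesInCube_iff {n r : ℕ} {m : Fin n → ℤ} {l : List (Fin n → ℤ × ℕ)} :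
    AreCodesInCube r m l ↔
      ∃ L : List (Fin n → ℚ), l = L.map pointCode ∧ ∀ q ∈ L, ratPoint q ∈ dyadicCube r m := by
  simp only [ratPoint_mem_dyadicCube, ← isCodeInInterval_ratCode]
  constructor
  · intro h
    induction l with
    | nil => exact ⟨[], rfl, by simp⟩
    | cons p l ih =>
      obtain ⟨L, rfl, hL⟩ := ih fun x hx => h x (List.mem_cons_of_mem _ hx)
      have hp := h p List.mem_cons_self
      choose q hq using fun i => exists_ratCode_eq (hp i).1
      have hpq : p = pointCode q := funext fun i => (hq i).symm
      refine ⟨q :: L, by rw [List.map_cons, hpq], ?_⟩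
      rintro x hx
      rcases List.mem_cons.1 hx with rfl | hx
      · intro i; rw [hq i]; exact hp i
      · exact hL x hx
  · rintro ⟨L, rfl, hL⟩ p hp i
    obtain ⟨q, hq, rfl⟩ := List.mem_map.1 hp
    exact hL q hq i

theorem primrecPred_areCodesInCube {α : Type} [Primcodable α] {n : ℕ} {r : α → ℕ}
    {m : α → Fin n → ℤ} {l : α → List (Fin n → ℤ × ℕ)} (hr : Primrec r) (hm : Primrec m)
    (hl : Primrec l) : PrimrecPred fun x => AreCodesInCube (r x) (m x) (l x) := by
  have h : PrimrecRel fun (p : Fin n → ℤ × ℕ) (y : ℕ × (Fin n → ℤ)) =>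
      ∀ i, IsCodeInInterval y.1 (y.2 i) (p i) :=
    primrecPred_forall_fin fun i => primrecPred_isCodeInInterval (Primrec.fst.comp Primrec.snd)
      (Primrec.fin_app.comp (Primrec.snd.comp Primrec.snd) (Primrec.const i))
      (Primrec.fin_app.comp Primrec.fst (Primrec.const i))
  exact h.forall_mem_list.comp hl (Primrec.pair hr hm)

theorem primrecPred_isCodeOfCorner {α : Type} [Primcodable α] {n : ℕ} {r : α → ℕ}
    {m : α → Fin n → ℤ} {p : α → Fin n → ℤ × ℕ} (hr : Primrec r) (hm : Primrec m)
    (hp : Primrec p) : PrimrecPred fun x => p x = pointCode (cubeCorner (r x) (m x)) := by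
  have h : PrimrecPred fun x => ∀ i, IsCodeOfDyadic (r x) (m x i) (p x i) :=
    primrecPred_forall_fin fun i => primrecPred_isCodeOfDyadic hr
      (Primrec.fin_app.comp hm (Primrec.const i)) (Primrec.fin_app.comp hp (Primrec.const i))
  refine h.of_eq fun x => ?_
  simp only [isCodeOfDyadic_iff]
  exact funext_iff.symm

/-! ### The weight of the requests for the corners of cubes -/

-- The admissible exponents start at some least `k₀`, and the geometric tail from there is `2 * 2 ^
-- (-k₀) ≤ 2 * x`. Hence requesting every admissible exponent costs only a factor 2.
open Classical in
theorem tsum_two_pow_le (x : ℝ≥0∞) :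
    ∑' k : ℕ, (if (2⁻¹ : ℝ≥0∞) ^ k ≤ x then (2⁻¹ : ℝ≥0∞) ^ k else 0) ≤ 2 * x := by
  by_cases h : ∃ k : ℕ, (2⁻¹ : ℝ≥0∞) ^ k ≤ x
  · have hfind := Nat.find_spec h
    calc ∑' k : ℕ, (if (2⁻¹ : ℝ≥0∞) ^ k ≤ x then (2⁻¹ : ℝ≥0∞) ^ k else 0)
        = ∑' k : ℕ, (if (2⁻¹ : ℝ≥0∞) ^ (k + Nat.find h) ≤ x
            then (2⁻¹ : ℝ≥0∞) ^ (k + Nat.find h) else 0) := by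
          rw [← ENNReal.summable.sum_add_tsum_nat_add' (k := Nat.find h), Finset.sum_eq_zero,
            zero_add]
          intro k hk
          rw [if_neg (Nat.find_min h (Finset.mem_range.1 hk))]
      _ ≤ ∑' k : ℕ, (2⁻¹ : ℝ≥0∞) ^ (k + Nat.find h) := by
          refine ENNReal.tsum_le_tsum fun k => ?_
          split_ifs
          · exact le_rfl
          · exact zero_le
      _ = 2 * (2⁻¹ : ℝ≥0∞) ^ Nat.find h := by
          simp_rw [pow_add]
          rw [ENNReal.tsum_mul_right, ENNReal.tsum_geometric, ENNReal.one_sub_inv_two, inv_inv]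
      _ ≤ 2 * x := by gcongr
  · push Not at h
    rw [ENNReal.tsum_eq_zero.2]
    · exact zero_le
    · intro k
      rw [if_neg (h k).not_ge]

open Classical in
theorem measure_le_tsum_points {n : ℕ} {ν : OuterMeasure (EuclideanSpace ℝ (Fin n))}
    (hν : IsSupportedOnRat ν) (E : Set (EuclideanSpace ℝ (Fin n))) :
    ν E ≤ ∑' q : Fin n → ℚ, if ratPoint q ∈ E then ν {ratPoint q} else 0 := by
  have hsub : E ⊆ (Set.range (ratPoint (n := n)))ᶜ ∪
      ⋃ q : Fin n → ℚ, if ratPoint q ∈ E then {ratPoint q} else ∅ := by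
    intro x hx
    by_cases hr : x ∈ Set.range (ratPoint (n := n))
    · obtain ⟨q, rfl⟩ := hr
      exact Or.inr (Set.mem_iUnion.2 ⟨q, by simp [hx]⟩)
    · exact Or.inl hr
  refine (measure_mono hsub).trans ((measure_union_le _ _).trans ?_)
  rw [show ν (Set.range (ratPoint (n := n)))ᶜ = 0 from hν, zero_add]
  refine (measure_iUnion_le _).trans (ENNReal.tsum_le_tsum fun q => ?_)
  split_ifs <;> simp

/-- Each rational point lies in a single cube of level `r`, whose address is given by floors, so its
mass is charged only once. -/
theorem tsum_dyadicCube_le {n : ℕ} {ν : OuterMeasure (EuclideanSpace ℝ (Fin n))}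
    (hν : IsSupportedOnRat ν) (r : ℕ) :
    ∑' m : Fin n → ℤ, ν (dyadicCube r m) ≤ ∑' q : Fin n → ℚ, ν {ratPoint q} := by
  classical
  refine (ENNReal.tsum_le_tsum fun m => measure_le_tsum_points hν (dyadicCube r m)).trans ?_
  rw [ENNReal.tsum_comm]
  refine ENNReal.tsum_le_tsum fun q => ?_
  calc _ ≤ ∑' m : Fin n → ℤ, (if m = (fun i => ⌊q i * 2 ^ r⌋) then ν {ratPoint q} else 0) := by
        refine ENNReal.tsum_le_tsum fun m => ?_
        split_ifs with h1 h2
        · exact le_rfl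
        · exact absurd (funext fun i => (Int.floor_eq_iff.2
            (ratPoint_mem_dyadicCube.1 h1 i)).symm) h2
        · exact zero_le
        · exact le_rfl
    _ = _ := tsum_ite_eq _ _

-- Each level would cost up to `2 * s` by itself. Attaching a program of `r` to the request makes
-- the sum over all levels converge: a program prints at most one `r`, and the program weights sum
-- to at most 1.
open Classical in
theorem tsum_corner_requests_le {U : List Bool →. List Bool} (hU : IsPrefixMachine U) {n : ℕ}
    {ν : OuterMeasure (EuclideanSpace ℝ (Fin n))} (hν : IsSupportedOnRat ν) :
    ∑' x : List Bool × ℕ × (Fin n → ℤ) × ℕ,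
      (if binaryCode x.2.1 ∈ U x.1 ∧ (2⁻¹ : ℝ≥0∞) ^ x.2.2.2 ≤ ν (dyadicCube x.2.1 x.2.2.1)
        then (2⁻¹ : ℝ≥0∞) ^ (x.1.length + x.2.2.2) else 0) ≤
      2 * ∑' q : Fin n → ℚ, ν {ratPoint q} := by
  set s := ∑' q : Fin n → ℚ, ν {ratPoint q}
  calc _ = ∑' (π : List Bool) (r : ℕ) (m : Fin n → ℤ) (k : ℕ),
        (if binaryCode r ∈ U π then (2⁻¹ : ℝ≥0∞) ^ π.length else 0) *
          (if (2⁻¹ : ℝ≥0∞) ^ k ≤ ν (dyadicCube r m) then (2⁻¹ : ℝ≥0∞) ^ k else 0) := by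
        rw [ENNReal.tsum_prod']
        refine tsum_congr fun π => ?_
        rw [ENNReal.tsum_prod']
        refine tsum_congr fun r => ?_
        rw [ENNReal.tsum_prod']
        refine tsum_congr fun m => tsum_congr fun k => ?_
        by_cases h1 : binaryCode r ∈ U π <;>
          by_cases h2 : (2⁻¹ : ℝ≥0∞) ^ k ≤ ν (dyadicCube r m) <;> simp [h1, h2, pow_add]
    _ ≤ ∑' (π : List Bool) (r : ℕ),
        (if binaryCode r ∈ U π then (2⁻¹ : ℝ≥0∞) ^ π.length else 0) * (2 * s) := by
        refine ENNReal.tsum_le_tsum fun π => ENNReal.tsum_le_tsum fun r => ?_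
        simp_rw [ENNReal.tsum_mul_left]
        gcongr
        refine (ENNReal.tsum_le_tsum fun m => tsum_two_pow_le _).trans ?_
        rw [ENNReal.tsum_mul_left]
        gcongr
        exact tsum_dyadicCube_le hν r
    _ ≤ ∑' π : List Bool, (if (U π).Dom then (2⁻¹ : ℝ≥0∞) ^ π.length else 0) * (2 * s) := by
        refine ENNReal.tsum_le_tsum fun π => ?_
        rw [ENNReal.tsum_mul_right]
        gcongr
        by_cases h : ∃ r : ℕ, binaryCode r ∈ U π
        · obtain ⟨r, hr⟩ := h
          rw [tsum_eq_single r, if_pos hr, if_pos (Part.dom_iff_mem.2 ⟨_, hr⟩)]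
          intro r' hr'
          rw [if_neg fun h => hr' (binaryCode_injective (Part.mem_unique h hr))]
        · push Not at h
          rw [ENNReal.tsum_eq_zero.2]
          · exact zero_le
          · intro r
            rw [if_neg (h r)]
    _ ≤ 1 * (2 * s) := by
        rw [ENNReal.tsum_mul_right]
        gcongr
        exact hU.tsum_le_one
    _ = 2 * s := one_mul _

/-! ### The complexity of the corner of a cube -/

theorem two_pow_neg_le_ratCode_iff (k : ℕ) (x : ℚ≥0) :
    (ratCode (x : ℚ)).2 ≤ (ratCode (x : ℚ)).1.toNat * 2 ^ k ↔
      (2⁻¹ : ℝ≥0∞) ^ k ≤ ((x : ℝ≥0) : ℝ≥0∞) := by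
  have h1 : (2⁻¹ : ℝ≥0∞) ^ k = (((2⁻¹ : ℝ≥0) ^ k : ℝ≥0) : ℝ≥0∞) := by push_cast; rfl
  have h2 : (2⁻¹ : ℝ≥0) ^ k = ((((2 : ℚ≥0) ^ k)⁻¹ : ℚ≥0) : ℝ≥0) := by push_cast; rw [inv_pow]
  rw [h1, ENNReal.coe_le_coe, h2, NNRat.cast_le, ← NNRat.coe_le_coe]
  push_cast
  have hx : (0 : ℚ) ≤ x := x.2
  generalize (x : ℚ) = y at hx
  have hd : (0 : ℚ) < y.den := by exact_mod_cast y.den_pos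
  have hn : ((y.num.toNat : ℕ) : ℚ) = y.num := by
    have : ((y.num.toNat : ℕ) : ℤ) = y.num := Int.toNat_of_nonneg (Rat.num_nonneg.2 hx)
    exact_mod_cast this
  conv_rhs => rw [← Rat.num_div_den y, inv_eq_one_div,
    div_le_div_iff₀ (by positivity) hd, one_mul, ← hn]
  change y.den ≤ y.num.toNat * 2 ^ k ↔ _
  exact_mod_cast Iff.rfl

/-- If `π` is a program for `r` and the approximations to `ν` show that a finite part of a cube of
level `r` has mass at least `2 ^ (-k)`, then the complexity of the corner of the cube is at most
`|π| + k` up to a constant. -/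
theorem exists_corner_complexity_le {U : List Bool →. List Bool}
    (hU : IsUniversalPrefixMachine U) {n : ℕ} {ν : OuterMeasure (EuclideanSpace ℝ (Fin n))}
    (hν : IsStronglyFinite ν) {f : Finset (Fin n → ℚ) → ℕ → ℚ≥0} (hf : IsComputableOnFinsets f)
    (hle : ∀ A t, ((f A t : ℝ≥0) : ℝ≥0∞) ≤ ν (ratPoint '' (A : Set (Fin n → ℚ)))) :
    ∃ c : ℕ, ∀ (π : List Bool) (r : ℕ) (m : Fin n → ℤ) (A : Finset (Fin n → ℚ)) (t k : ℕ),
      binaryCode r ∈ U π → (∀ q ∈ A, ratPoint q ∈ dyadicCube r m) →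
      (2⁻¹ : ℝ≥0∞) ^ k ≤ ((f A t : ℝ≥0) : ℝ≥0∞) →
      pointComplexity U (cubeCorner r m) ≤ (π.length + k + c : ℕ) := by
  classical
  obtain ⟨F, hF, hFf⟩ := hf
  obtain ⟨S, hS, -, hSU⟩ := exists_primrec_stages hU.isPrefixMachine.partrec
  obtain ⟨T, hT, -, hTF⟩ := exists_primrec_stages 
    (f := fun x : List (Fin n → ℤ × ℕ) × ℕ => Part.some (F x.1 x.2)) hF
  -- The witness carries all that has to be searched for: the stages `s` and `u` at which `U` and
  -- the algorithm for `ν` halt, the address, the code of the corner, a finite part of the cube, the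
  -- approximation stage `t` and its value `v`. What remains is a primitive recursive check.
  let B := (List Bool × ℕ × ℕ × ℕ) ×
    ((Fin n → ℤ) × (Fin n → ℤ × ℕ) × List (Fin n → ℤ × ℕ)) × ℕ × ℕ × ℤ × ℕ
  let D : ℕ × List Bool → B → Prop := fun p ⟨⟨π, r, s, k⟩, ⟨m, a, l⟩, t, u, v⟩ =>
    p = (π.length + k, binaryCode a) ∧ S s π = some (binaryCode r) ∧
      a = pointCode (cubeCorner r m) ∧ AreCodesInCube r m l ∧
      T u (l, t) = some v ∧ v.2 ≤ v.1.toNat * 2 ^ k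
  have hD : PrimrecRel D := by
    have w : Primrec fun x : (ℕ × List Bool) × B => x.2 := Primrec.snd
    have w₁ := Primrec.fst.comp w
    have hπ := Primrec.fst.comp w₁
    have hr := Primrec.fst.comp (Primrec.snd.comp w₁)
    have hs := Primrec.fst.comp (Primrec.snd.comp (Primrec.snd.comp w₁))
    have hk := Primrec.snd.comp (Primrec.snd.comp (Primrec.snd.comp w₁))
    have w₂ := Primrec.fst.comp (Primrec.snd.comp w)
    have hm := Primrec.fst.comp w₂
    have ha := Primrec.fst.comp (Primrec.snd.comp w₂)
    have hl := Primrec.snd.comp (Primrec.snd.comp w₂)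
    have w₃ := Primrec.snd.comp (Primrec.snd.comp w)
    have ht := Primrec.fst.comp w₃
    have hu := Primrec.fst.comp (Primrec.snd.comp w₃)
    have hv := Primrec.snd.comp (Primrec.snd.comp w₃)
    have h₁ := Primrec.eq.comp (Primrec.fst (α := ℕ × List Bool) (β := B))
      (Primrec.pair (Primrec.nat_add.comp (Primrec.list_length.comp hπ) hk)
        (primrec_binaryCode.comp ha))
    have h₂ := Primrec.eq.comp (hS.comp hs hπ)
      (Primrec.option_some.comp (primrec_binaryCode.comp hr))
    have h₃ := primrecPred_isCodeOfCorner hr hm ha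
    have h₄ := primrecPred_areCodesInCube hr hm hl
    have h₅ := Primrec.eq.comp (hT.comp hu (Primrec.pair hl ht)) (Primrec.option_some.comp hv)
    have h₆ := Primrec.nat_le.comp (Primrec.snd.comp hv)
      (Primrec.nat_mul.comp (primrec_int_toNat.comp (Primrec.fst.comp hv))
        (primrec_nat_pow.comp (Primrec.const 2) hk))
    exact h₁.and (h₂.and (h₃.and (h₄.and (h₅.and h₆))))
  have hsum : ∑' p : ℕ × List Bool, (if ∃ b, D p b then (2⁻¹ : ℝ≥0∞) ^ p.1 else 0) ≠ ⊤ := by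
    refine ne_top_of_le_ne_top ?_ ((tsum_requests_le (ι := List Bool × ℕ × (Fin n → ℤ) × ℕ)
      (V := fun x => binaryCode x.2.1 ∈ U x.1 ∧
        (2⁻¹ : ℝ≥0∞) ^ x.2.2.2 ≤ ν (dyadicCube x.2.1 x.2.2.1))
      (g := fun x => (x.1.length + x.2.2.2, binaryCode (pointCode (cubeCorner x.2.1 x.2.2.1))))
      ?_).trans (tsum_corner_requests_le hU.isPrefixMachine hν.1))
    · exact ENNReal.mul_ne_top (by norm_num) hν.2.ne
    -- The approximations are lower bounds for `ν`, so a certified request really satisfies `2 ^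
    -- (-k) ≤ ν(Q)`.
    · rintro p ⟨⟨⟨π, r, s, k⟩, ⟨m, a, l⟩, t, u, v⟩, rfl, hs, rfl, hl, hu, hv⟩
      obtain ⟨L, rfl, hL⟩ := areCodesInCube_iff.1 hl
      refine ⟨(π, r, m, k), ⟨(hSU _ _).2 ⟨s, hs⟩, ?_⟩, rfl⟩
      obtain rfl : v = F (L.map pointCode) t := Part.mem_some_iff.1 ((hTF _ _).2 ⟨u, hu⟩)
      rw [hFf, two_pow_neg_le_ratCode_iff] at hv
      refine hv.trans ((hle _ t).trans (measure_mono ?_))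
      rintro _ ⟨q, hq, rfl⟩
      exact hL q (by simpa using hq)
  obtain ⟨c, hc⟩ := exists_stringComplexity_le hU hD hsum
  refine ⟨c, fun π r m A t k hπ hA hk => ?_⟩
  obtain ⟨s, hs⟩ := (hSU _ _).1 hπ
  obtain ⟨u, hu⟩ := (hTF (A.toList.map pointCode, t) _).1 (Part.mem_some _)
  refine hc (π.length + k, binaryCode (pointCode (cubeCorner r m)))
    ⟨⟨π, r, s, k⟩, ⟨m, pointCode (cubeCorner r m), A.toList.map pointCode⟩, t, u, _⟩
    ⟨rfl, hs, rfl, areCodesInCube_iff.2 ⟨A.toList, rfl, by simpa using hA⟩, hu, ?_⟩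
  simp only [hFf, Finset.toList_toFinset]
  exact (two_pow_neg_le_ratCode_iff k (f A t)).2 hk

/-! ### Domination on dyadic cubes -/

/-- For `r ≥ 1` the binary length is at most `1 + log₂ r`. -/
theorem natSize_isLittleO : (fun r : ℕ => (r.size : ℝ)) =o[atTop] fun r : ℕ => (r : ℝ) := by
  have hlog : (fun r : ℕ => 1 + (Real.log 2)⁻¹ * Real.log r) =o[atTop] fun r : ℕ => (r : ℝ) := by
    refine IsLittleO.add ?_ (IsLittleO.const_mul_left ?_ _)
    · exact (isLittleO_const_id_atTop (1 : ℝ)).comp_tendsto tendsto_natCast_atTop_atTop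
    · exact Real.isLittleO_log_id_atTop.comp_tendsto tendsto_natCast_atTop_atTop
  refine IsBigO.trans_isLittleO (IsBigO.of_bound 1 ?_) hlog
  filter_upwards [eventually_ge_atTop 1] with r hr
  obtain ⟨j, hj⟩ : ∃ j, r.size = j + 1 :=
    Nat.exists_eq_succ_of_ne_zero (Nat.size_pos.2 hr).ne'
  have h1 : 2 ^ j ≤ r := Nat.lt_size.1 (by omega)
  have hl2 : 0 < Real.log 2 := Real.log_pos (by norm_num)
  have h2 : (j : ℝ) * Real.log 2 ≤ Real.log r := by
    rw [← Real.log_pow]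
    exact Real.log_le_log (by positivity) (by exact_mod_cast h1)
  have h3 : (j : ℝ) ≤ (Real.log 2)⁻¹ * Real.log r := by
    rw [inv_mul_eq_div, le_div_iff₀ hl2]; exact h2
  rw [one_mul, Real.norm_of_nonneg (by positivity)]
  refine le_trans ?_ (le_abs_self _)
  rw [hj]
  push_cast
  linarith

theorem natComplexity_isLittleO {U : List Bool →. List Bool} (hU : IsUniversalPrefixMachine U) :
    (fun r : ℕ => ((natComplexity U r).toNat : ℝ)) =o[atTop] fun r : ℕ => (r : ℝ) := by
  obtain ⟨c, hc⟩ := exists_stringComplexity_bits_le hU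
  have h : (fun r : ℕ => 2 * (r.size : ℝ) + c) =o[atTop] fun r : ℕ => (r : ℝ) :=
    (natSize_isLittleO.const_mul_left 2).add
      ((isLittleO_const_id_atTop (c : ℝ)).comp_tendsto tendsto_natCast_atTop_atTop)
  refine IsBigO.trans_isLittleO (IsBigO.of_bound 1 (Eventually.of_forall fun r => ?_)) h
  have h1 : (natComplexity U r).toNat ≤ 2 * r.size + c := ENat.toNat_le_of_le_natCast (hc r)
  rw [one_mul, Real.norm_of_nonneg (by positivity), Real.norm_of_nonneg (by positivity)]
  exact_mod_cast h1

/-- Take the least admissible `k`. If `k > 0`, minimality gives `y < 2 * 2 ^ (-k)`; if `k = 0`, then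
`y` may exceed 1 and only `y ≤ C` is available. The factor `2 + C` covers both cases. -/
theorem exists_two_pow_near {y C : ℝ≥0} (hy : 0 < y) (hC : y ≤ C) :
    ∃ k : ℕ, (2⁻¹ : ℝ≥0) ^ k ≤ y ∧ y ≤ (2 + C) * (2⁻¹ : ℝ≥0) ^ k := by
  classical
  have hex : ∃ k : ℕ, (2⁻¹ : ℝ≥0) ^ k ≤ y :=
    (exists_pow_lt_of_lt_one hy (by norm_num [inv_lt_one_iff₀])).imp fun _ h => h.le
  refine ⟨Nat.find hex, Nat.find_spec hex, ?_⟩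
  rcases Nat.eq_zero_or_pos (Nat.find hex) with h0 | hpos
  · rw [h0, pow_zero, mul_one]
    exact hC.trans le_add_self
  · have h1 := Nat.find_min hex (Nat.sub_lt hpos one_pos)
    push Not at h1
    have h2 : (2⁻¹ : ℝ≥0) ^ (Nat.find hex - 1) = 2 * (2⁻¹ : ℝ≥0) ^ Nat.find hex := by
      obtain ⟨j, hj⟩ := Nat.exists_eq_succ_of_ne_zero hpos.ne'
      rw [hj, Nat.succ_sub_one, pow_succ]
      field_simp
    rw [h2] at h1
    exact h1.le.trans (by gcongr; exact le_self_add)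

theorem IsStronglyFinite.measure_le {n : ℕ} {ν : OuterMeasure (EuclideanSpace ℝ (Fin n))}
    (hν : IsStronglyFinite ν) (E : Set (EuclideanSpace ℝ (Fin n))) :
    ν E ≤ ∑' q : Fin n → ℚ, ν {ratPoint q} := by
  classical
  refine (measure_le_tsum_points hν.1 E).trans (ENNReal.tsum_le_tsum fun q => ?_)
  split_ifs
  · exact le_rfl
  · exact zero_le

/-- Intersect with `E` a finite set outside which the mass is below `y`; by subadditivity more than
half of `ν E` remains. The strict inequality lets an approximation exceed `y` at some finite stage.
-/
theorem IsFinitelySupportedOnRat.exists_finset {n : ℕ}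
    {ν : OuterMeasure (EuclideanSpace ℝ (Fin n))} (hν : IsFinitelySupportedOnRat ν)
    {E : Set (EuclideanSpace ℝ (Fin n))} {y : ℝ≥0} (hy : 0 < y) (hE : ν E = (2 * y : ℝ≥0)) :
    ∃ A : Finset (Fin n → ℚ), (∀ q ∈ A, ratPoint q ∈ E) ∧
      (y : ℝ≥0∞) < ν (ratPoint '' (A : Set (Fin n → ℚ))) := by
  classical
  obtain ⟨B, hB⟩ := hν y hy
  refine ⟨B.filter fun q => ratPoint q ∈ E, fun q hq => (Finset.mem_filter.1 hq).2, ?_⟩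
  have hsub : E ⊆ ratPoint '' ((B.filter fun q => ratPoint q ∈ E : Finset (Fin n → ℚ)) :
      Set (Fin n → ℚ)) ∪ (ratPoint '' (B : Set (Fin n → ℚ)))ᶜ := by
    intro x hx
    by_cases h : x ∈ ratPoint '' (B : Set (Fin n → ℚ))
    · obtain ⟨q, hq, rfl⟩ := h
      exact Or.inl ⟨q, by simpa using ⟨hq, hx⟩, rfl⟩
    · exact Or.inr h
  by_contra! hle
  have h1 := (measure_mono (μ := ν) hsub).trans (measure_union_le _ _)
  have h2 : ν E < y + y := h1.trans_lt (ENNReal.add_lt_add_of_le_of_lt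
    (ne_top_of_le_ne_top ENNReal.coe_ne_top hle) hle hB)
  rw [hE, two_mul, ENNReal.coe_add] at h2
  exact lt_irrefl _ h2

theorem twoPowNeg_add (a b : ℕ) : twoPowNeg ((a + b : ℕ) : ℕ∞) = twoPowNeg a * twoPowNeg b := by
  simp only [twoPowNeg_coe, pow_add]

theorem exists_kappa_dominatesWith {U : List Bool →. List Bool}
    (hU : IsUniversalPrefixMachine U) {n : ℕ} {ν : OuterMeasure (EuclideanSpace ℝ (Fin n))}
    (hν : IsStronglyFinite ν) (hν' : IsLowerSemicomputable ν) :
    ∃ α : ℝ≥0, 0 < α ∧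
      DominatesWith (fun r => α * twoPowNeg (natComplexity U r)) (kappa U n) ν
        (dyadicCubes n) := by
  obtain ⟨hsupp, f, hf, hmono, hlim⟩ := hν'
  obtain ⟨c, hc⟩ := exists_corner_complexity_le hU hν hf fun A t => (hmono A t t le_rfl).2
  have hKcoe : ∀ r, natComplexity U r = ((natComplexity U r).toNat : ℕ∞) := fun r =>
    (ENat.natCast_toNat (natComplexity_ne_top hU r)).symm
  set C : ℝ≥0 := (∑' q : Fin n → ℚ, ν {ratPoint q}).toNNReal with hC
  have hCle : ∀ E, ν E ≤ C := fun E => by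
    rw [hC, ENNReal.coe_toNNReal hν.2.ne]; exact hν.measure_le E
  -- The factor 2 pays for passing to a finite part of the cube, `2 + C` for rounding to a power of
  -- two, and `2 ^ (-c)` for the complexity of the corner.
  set α : ℝ≥0 := (2 * (2 + C))⁻¹ * twoPowNeg c with hα
  have hαpos : 0 < α := by
    rw [hα, twoPowNeg_coe]; positivity
  -- The exponent comes from `α * 2 ^ (-K(r)) = 2 ^ (-(K(r) - log₂ α))`.
  refine ⟨α, hαpos, fun r => ?_, ⟨fun r => (natComplexity U r).toNat - Real.logb 2 α, ?_, ?_⟩, ?_⟩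
  · beta_reduce
    rw [hKcoe r, twoPowNeg_coe]
    positivity
  · exact (natComplexity_isLittleO hU).sub
      ((isLittleO_const_id_atTop (Real.logb 2 α)).comp_tendsto tendsto_natCast_atTop_atTop)
  · intro r
    rw [neg_sub, Real.rpow_sub two_pos,
      Real.rpow_logb two_pos (by norm_num) (by exact_mod_cast hαpos), Real.rpow_natCast]
    beta_reduce
    conv_lhs => rw [hKcoe r, twoPowNeg_coe]
    push_cast
    rw [inv_pow, div_eq_mul_inv]
  · rintro r _ ⟨m, rfl⟩
    by_cases h0 : ν (dyadicCube r m) = 0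
    · rw [h0, mul_zero]; exact zero_le
    have hfin : ν (dyadicCube r m) ≠ ⊤ := ne_top_of_le_ne_top ENNReal.coe_ne_top (hCle _)
    set y : ℝ≥0 := (ν (dyadicCube r m)).toNNReal / 2 with hy
    have hνy : ν (dyadicCube r m) = (2 * y : ℝ≥0) := by
      rw [hy, mul_div_cancel₀ _ two_ne_zero, ENNReal.coe_toNNReal hfin]
    have hypos : 0 < y := by
      rw [pos_iff_ne_zero]
      intro hy0
      rw [hνy, hy0] at h0
      simp at h0
    have hyC : y ≤ C := by
      have h1 := hCle (dyadicCube r m)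
      rw [hνy, ENNReal.coe_le_coe] at h1
      exact le_trans (by rw [two_mul]; exact le_self_add) h1
    obtain ⟨k, hk1, hk2⟩ := exists_two_pow_near hypos hyC
    obtain ⟨A, hA, hyA⟩ := hsupp.exists_finset hypos hνy
    obtain ⟨t, ht⟩ := ((hlim A).eventually (lt_mem_nhds hyA)).exists
    obtain ⟨π, hπ, hlen⟩ := exists_program (natComplexity_ne_top hU r)
    have hK : (natComplexity U r).toNat = π.length := by
      rw [natComplexity, ← hlen, ENat.toNat_natCast]
    have hcorner := hc π r m A t k hπ hA (by
      refine le_trans ?_ ht.le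
      rw [← coe_twoPowNeg, twoPowNeg_coe, ENNReal.coe_le_coe]
      exact hk1)
    have hset : setComplexity U (dyadicCube r m) ≤ (π.length + k + c : ℕ) :=
      (iInf₂_le (cubeCorner r m) (cubeCorner_mem r m)).trans hcorner
    rw [kappa_apply, hνy, ← ENNReal.coe_mul, ENNReal.coe_le_coe]
    refine le_trans ?_ (twoPowNeg_antitone hset)
    beta_reduce
    rw [twoPowNeg_add, twoPowNeg_add, hKcoe r, hK, hα]
    calc (2 * (2 + C))⁻¹ * twoPowNeg c * twoPowNeg π.length * (2 * y)
        ≤ (2 * (2 + C))⁻¹ * twoPowNeg c * twoPowNeg π.length * (2 * ((2 + C) * twoPowNeg k)) := by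
          gcongr
          exact hk2
      _ = twoPowNeg π.length * twoPowNeg k * twoPowNeg c := by
          have : (2 + C : ℝ≥0) ≠ 0 := by positivity
          field_simp

end KolmogorovOuter

theorem mainTheorem2 (n : ℕ) (U : List Bool →. List Bool)
    (hU : KolmogorovOuter.IsUniversalPrefixMachine U) :
    KolmogorovOuter.IsLocallyOptimal (KolmogorovOuter.kappa U n) ∧
    ∃ c : ℕ, ∀ ν : OuterMeasure (EuclideanSpace ℝ (Fin n)),
      KolmogorovOuter.IsStronglyFinite ν → KolmogorovOuter.IsLowerSemicomputable ν →
      ∃ α : ℝ≥0, 0 < α ∧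
        KolmogorovOuter.DominatesWith
          (fun r => α * KolmogorovOuter.twoPowNeg (KolmogorovOuter.natComplexity U r + c))
          (KolmogorovOuter.kappa U n) ν (KolmogorovOuter.dyadicCubes n) := by
  -- The constant `c` can be 0, because `α` may depend on `ν` and absorbs all additive constants.
  refine ⟨⟨⟨KolmogorovOuter.isStronglyFinite_kappa hU n,
    KolmogorovOuter.isLowerSemicomputable_kappa hU n⟩, fun ν hν hν' => ?_⟩, 0, fun ν hν hν' => ?_⟩
  · obtain ⟨α, -, h⟩ := KolmogorovOuter.exists_kappa_dominatesWith hU hν hν'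
    exact ⟨_, h⟩
  · obtain ⟨α, hα, h⟩ := KolmogorovOuter.exists_kappa_dominatesWith hU hν hν'
    exact ⟨α, hα, by simpa only [Nat.cast_zero, add_zero] using h⟩
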